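/- Conventions. Rings are associative with unity. Complexes are $\mathbb{Z}$-indexed with differentials $d_n\colon X_n\to X_{n-1}$; $X\simeq Y$ means that $X$ and $Y$ are linked by a finite zigzag of quasi-isomorphisms. Put $\inf X=\inf\{i\mid H_i(X)\neq 0\}$ (so $\inf X=\infty$ if $X$ is exact). A complex $P$ of projective modules is DG-projective if $\operatorname{Hom}(P,E)$ is exact for every exact complex $E$; a DG-projective resolution of $X$ is a quasi-isomorphism $P\to X$ with $P$ DG-projective. A complex $T$ of projective modules is totally $\mathcal F$-acyclic if $T$ is exact and $\operatorname{Hom}(T,F)$ is exact for every flat module $F$. For a complex $X$ of left $S$-modules, the Ding projective dimension $\mathrm{Dpd}_S(X)\in\{-\infty\}\cup\mathbb{Z}\cup\{\infty\}$ is the infimum of the integers $n$ for which there are morphisms of complexes $T\xrightarrow{\tau}P\xrightarrow{\pi}X$ with $\pi$ a DG-projective resolution, $T$ totally $\mathcal F$-acyclic, and $\tau_i$ bijective for all $i\ge n$. The projective dimension $\mathrm{pd}_R(U)$ is the infimum of the integers $n$ for which $U\simeq P$ for some bounded below complex $P$ of projective modules with $P_i=0$ for all $i>n$. In the formulas below,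 sums in $[-\infty,\infty]$ that involve both $\infty$ and $-\infty$ are read as $-\infty$ (this happens only if $U$ is exact, and then the left-hand sides are $-\infty$). Theorem. Let $\varphi\colon R\to S$ be a homomorphism of rings whose image lies in the center of $S$ (for instance, a homomorphism of commutative rings), and let $X$ be a homologically bounded below complex of left $S$-modules, i.e. $H_i(X)=0$ for all $i\ll 0$. For a complex $U$ of left (resp. right) $R$-modules with DG-projective resolution $P\to U$, let $\mathrm{RHom}_R(U,X)$ (resp. $U\otimes^{\mathbf L}_R X$) be the complex $\operatorname{Hom}_R(P,X)$ (resp. $P\otimes_R X$) of left $S$-modules, where $S$ acts through $X$; it is determined up to quasi-isomorphism. (1) If $U$ is a complex of left $R$-modules quasi-isomorphic to a bounded complex of finitely generated projective $R$-modules, then $\mathrm{Dpd}_S(\mathrm{RHom}_R(U,X))\le \mathrm{Dpd}_S(X)-\inf U$. (2) If $U$ is a complex of right $R$-modules of finite projective dimension, i.e. $\mathrm{pd}_R(U)<\infty$, then $\mathrm{Dpd}_S(U\otimes^{\mathbf L}_R X)\le \mathrm{Dpd}_S(X)+\mathrm{pd}_R(U)$. -/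

import Mathlib

open CategoryTheory TensorProduct

universe u

noncomputable section

namespace DingProj

/-- Complexes of left `R`-modules, with homological grading: `d : X_n ⟶ X_{n-1}`, `n ∈ ℤ`.
A left `Rᵐᵒᵖ`-module is a right `R`-module. -/
abbrev Cx (R : Type u) [Ring R] := ChainComplex (ModuleCat.{u} R) ℤ

/-! ### Tensor products over a noncommutative ring, and flat modules -/

section Balanced

variable (T R : Type*) [Ring T] [Ring R]
variable (A : Type*) [AddCommGroup A] [Module Rᵐᵒᵖ A]
variable {A' : Type*} [AddCommGroup A'] [Module Rᵐᵒᵖ A']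
variable (M : Type*) [AddCommGroup M] [Module R M] [Module T M]
variable {M' : Type*} [AddCommGroup M'] [Module R M'] [Module T M'] [SMulCommClass R T M']

/-- The relations `a ⊗ r m = a r ⊗ m` in `A ⊗_ℤ M`. The module `M` is written as the
left-hand factor because Mathlib lets scalars act on that factor. As the action of `T` on `M`
commutes with that of `R`, the `T`-span is the subgroup generated by these elements. -/
def balancedRel [SMulCommClass R T M] : Submodule T (M ⊗[ℤ] A) :=
  Submodule.span T {x | ∃ (r : R) (m : M) (a : A),
    x = (r • m) ⊗ₜ[ℤ] a - m ⊗ₜ[ℤ] (MulOpposite.op r • a)}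

/-- The tensor product `A ⊗_R M` of a right `R`-module `A` and a left `R`-module `M`, where `M`
carries in addition a left `T`-action commuting with that of `R`; it is a left
`T`-module through `t (a ⊗ m) = a ⊗ t m`. -/
abbrev BalTensor [SMulCommClass R T M] := (M ⊗[ℤ] A) ⧸ balancedRel T R A M

variable {A M} [SMulCommClass R T M]

/-- The map `f ⊗ g : A ⊗_R M → A' ⊗_R M'`. -/
def BalTensor.map (f : A →ₗ[Rᵐᵒᵖ] A') (g : M →ₗ[T] M') (hg : ∀ (r : R) m, g (r • m) = r • g m) :
    BalTensor T R A M →ₗ[T] BalTensor T R A' M' :=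
  Submodule.mapQ _ _ (AlgebraTensorModule.map g f.toAddMonoidHom.toIntLinearMap) (by
    refine Submodule.span_le.2 ?_
    rintro _ ⟨r, m, a, rfl⟩
    refine Submodule.subset_span ⟨r, g m, f a, ?_⟩
    simp [hg])

@[simp]
theorem BalTensor.map_mk (f : A →ₗ[Rᵐᵒᵖ] A') (g : M →ₗ[T] M')
    (hg : ∀ (r : R) m, g (r • m) = r • g m) (m : M) (a : A) :
    BalTensor.map T R f g hg (Submodule.Quotient.mk (m ⊗ₜ[ℤ] a)) =
      Submodule.Quotient.mk (g m ⊗ₜ[ℤ] f a) := rfl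

/-- Two linear maps out of `A ⊗_R M` that agree on pure tensors are equal. -/
theorem BalTensor.hom_ext {N : Type*} [AddCommGroup N] [Module T N]
    {f g : BalTensor T R A M →ₗ[T] N}
    (h : ∀ m a, f (Submodule.Quotient.mk (m ⊗ₜ[ℤ] a)) = g (Submodule.Quotient.mk (m ⊗ₜ[ℤ] a))) :
    f = g := by
  refine Submodule.linearMap_qext _ ?_
  ext m a
  exact h m a

end Balanced

/-- A left `R`-module `F` is flat if `- ⊗_R F` preserves injections of right `R`-modules. -/
def IsFlat (R : Type u) [Ring R] (F : Type u) [AddCommGroup F] [Module R F] : Prop :=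
  ∀ (A B : ModuleCat.{u} Rᵐᵒᵖ) (f : A →ₗ[Rᵐᵒᵖ] B), Function.Injective f →
    Function.Injective (BalTensor.map ℤ R f (LinearMap.id : F →ₗ[ℤ] F) (fun _ _ => rfl))

/-! ### Complexes -/

section Complexes

variable {R : Type u} [Ring R]

/-- `X` and `Y` are quasi-isomorphic (`X ≃ Y`): they are linked by a finite zigzag of
quasi-isomorphisms. -/
def QuasiIsomorphic (X Y : Cx R) : Prop :=
  Relation.EqvGen (fun K L : Cx R => ∃ f : K ⟶ L, QuasiIso f) X Y

/-- `H_i(X) = 0` for all `i ≪ 0`. -/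
def HomologicallyBoundedBelow (X : Cx R) : Prop :=
  ∃ n : ℤ, ∀ i < n, X.ExactAt i

/-- `inf X = inf {i | H_i(X) ≠ 0}`, which is `∞` if `X` is exact. -/
def cxInf (X : Cx R) : EReal :=
  sInf {x : EReal | ∃ i : ℤ, x = ((i : ℝ) : EReal) ∧ ¬ X.ExactAt i}

/-- A DG-projective complex: a complex `P` of projective modules such that `Hom_R(P, E)` is exact
for every exact complex `E`. As exact complexes are stable under shift, the latter says
that every morphism from `P` to an exact complex is null-homotopic. -/
structure IsDGProjective (P : Cx R) : Prop where
  projective : ∀ n, Module.Projective R (P.X n)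
  homotopy_zero : ∀ (E : Cx R), E.Acyclic → ∀ f : P ⟶ E, Nonempty (Homotopy f 0)

/-- A DG-projective resolution `π : P ⟶ X`. -/
structure IsDGProjectiveResolution {P X : Cx R} (π : P ⟶ X) : Prop where
  dgProjective : IsDGProjective P
  quasiIso : QuasiIso π

/-- The projective dimension of a complex: the infimum of those `n` for which `X ≃ P` for
a bounded below complex `P` of projective modules with `P_i = 0` for all `i > n`.
It is `-∞` if `X` is exact, and `∞` if there is no such `n`. -/
def pd (X : Cx R) : EReal :=
  sInf {x : EReal | ∃ n : ℤ, x = ((n : ℝ) : EReal) ∧ ∃ P : Cx R, QuasiIsomorphic P X ∧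
    (∀ i, Module.Projective R (P.X i)) ∧ (∃ m : ℤ, ∀ i < m, Subsingleton (P.X i)) ∧
    ∀ i > n, Subsingleton (P.X i)}

/-- `X` is quasi-isomorphic to a bounded complex of finitely generated projective modules. -/
def IsPerfect (X : Cx R) : Prop :=
  ∃ P : Cx R, QuasiIsomorphic P X ∧
    (∀ i, Module.Finite R (P.X i) ∧ Module.Projective R (P.X i)) ∧
    ∃ m n : ℤ, ∀ i, (i < m ∨ n < i) → Subsingleton (P.X i)

/-- Totally `𝓕`-acyclic complexes, `𝓕` the class of flat modules: exact complexes `T` of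
projective modules such that `Hom_R(T, F)` is exact for every flat module `F`. -/
structure IsTotallyFlatAcyclic (T : Cx R) : Prop where
  projective : ∀ n, Module.Projective R (T.X n)
  exact : T.Acyclic
  hom_exact : ∀ F : ModuleCat.{u} R, IsFlat R F → ∀ (n : ℤ) (f : T.X n ⟶ F),
    T.d (n + 1) n ≫ f = 0 → ∃ g : T.X (n - 1) ⟶ F, T.d n (n - 1) ≫ g = f

/-- An `𝓕`-complete resolution `T ⟶ P ⟶ X` of `X`. -/
structure FCompleteResolution (X : Cx R) where
  T : Cx R
  P : Cx R
  τ : T ⟶ P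
  π : P ⟶ X
  resolution : IsDGProjectiveResolution π
  totallyAcyclic : IsTotallyFlatAcyclic T
  bijective : ∃ m : ℤ, ∀ i ≥ m, Function.Bijective (τ.f i)

/-- The Ding projective dimension of a complex: the infimum of those `n` for which there is an
`𝓕`-complete resolution `T ⟶ P ⟶ X` with `T_i ⟶ P_i` bijective for all `i ≥ n`. -/
def dpd (X : Cx R) : EReal :=
  sInf {x : EReal | ∃ n : ℤ, x = ((n : ℝ) : EReal) ∧
    ∃ C : FCompleteResolution X, ∀ i ≥ n, Function.Bijective (C.τ.f i)}

end Complexes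

/-! ### `Hom` and tensor product along a ring homomorphism with central image -/

section Functors

variable {R S : Type u} [Ring R] [Ring S] (φ : R →+* S)

/-- An `S`-module, viewed as an `R`-module through `φ`. -/
abbrev res (M : ModuleCat.{u} S) : ModuleCat.{u} R := (ModuleCat.restrictScalars φ).obj M

theorem res_smulCommClass (hφ : ∀ r s, φ r * s = s * φ r) (M : ModuleCat.{u} S) :
    SMulCommClass R S (res φ M) :=
  ⟨fun r s m => by
    change φ r • s • (show M from m) = s • φ r • (show M from m)
    rw [smul_smul, smul_smul, hφ]⟩

theorem res_smulCommClass' (hφ : ∀ r s, φ r * s = s * φ r) (M : ModuleCat.{u} S) :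
    SMulCommClass S R (res φ M) :=
  haveI := res_smulCommClass φ hφ M
  SMulCommClass.symm R S (res φ M)

variable (hφ : ∀ r s, φ r * s = s * φ r)

/-- The left `S`-module `A ⊗_R M`, for a right `R`-module `A` and a left `S`-module `M`, with
`s (a ⊗ m) = a ⊗ s m`; functorial in `A` and `M`. -/
def tensorBifunctor : ModuleCat.{u} Rᵐᵒᵖ ⥤ ModuleCat.{u} S ⥤ ModuleCat.{u} S where
  obj A :=
    { obj := fun M =>
        haveI := res_smulCommClass φ hφ M
        ModuleCat.of S (BalTensor S R A (res φ M))
      map := fun {M M'} g =>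
        haveI := res_smulCommClass φ hφ M
        haveI := res_smulCommClass φ hφ M'
        ModuleCat.ofHom (BalTensor.map S R (A := A) (A' := A) (M := res φ M) (M' := res φ M')
          LinearMap.id g.hom (fun r m => g.hom.map_smul (φ r) m))
      map_id := fun M => by
        have := res_smulCommClass φ hφ M
        ext : 1
        exact BalTensor.hom_ext S R (fun m a => rfl)
      map_comp := fun {M M' M''} g g' => by
        have := res_smulCommClass φ hφ M
        have := res_smulCommClass φ hφ M'
        have := res_smulCommClass φ hφ M''
        ext : 1
        exact BalTensor.hom_ext S R (fun m a => rfl) }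
  map {A A'} f :=
    { app := fun M =>
        haveI := res_smulCommClass φ hφ M
        ModuleCat.ofHom (BalTensor.map S R (A := A) (A' := A') (M := res φ M) (M' := res φ M)
          f.hom LinearMap.id (fun r m => rfl))
      naturality := fun M M' g => by
        have := res_smulCommClass φ hφ M
        have := res_smulCommClass φ hφ M'
        ext : 1
        exact BalTensor.hom_ext S R (fun m a => rfl) }
  map_id A := by
    ext M : 3
    have := res_smulCommClass φ hφ M
    exact BalTensor.hom_ext S R (fun m a => rfl)
  map_comp {A A' A''} f f' := by
    ext M : 3
    have := res_smulCommClass φ hφ M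
    exact BalTensor.hom_ext S R (fun m a => rfl)

instance : (tensorBifunctor φ hφ).Additive where
  map_add {A A' f g} := by
    ext M : 3
    have := res_smulCommClass φ hφ M
    refine BalTensor.hom_ext S R (fun m a => ?_)
    exact congrArg Submodule.Quotient.mk (TensorProduct.tmul_add m (f.hom a) (g.hom a))

instance (A : ModuleCat.{u} Rᵐᵒᵖ) : ((tensorBifunctor φ hφ).obj A).Additive where
  map_add {M M' f g} := by
    ext : 1
    have := res_smulCommClass φ hφ M
    have := res_smulCommClass φ hφ M'
    refine BalTensor.hom_ext S R (fun m a => ?_)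
    exact congrArg Submodule.Quotient.mk (TensorProduct.add_tmul (f.hom m) (g.hom m) a)

/-- The usual signs for the total complex of a tensor product of `ℤ`-graded chain complexes. -/
instance : ComplexShape.TensorSigns (ComplexShape.down ℤ) where
  ε' := MonoidHom.mk' Int.negOnePow Int.negOnePow_add
  rel_add p q r hpq := by
    change q + 1 = p at hpq
    change q + r + 1 = p + r
    lia
  add_rel p q r hpq := by
    change q + 1 = p at hpq
    change r + q + 1 = r + p
    lia
  ε'_succ := by
    rintro _ q rfl
    change q.negOnePow = - (q + 1).negOnePow
    rw [Int.negOnePow_succ, neg_neg]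

/-- The tensor product complex `P ⊗_R X`: `(P ⊗_R X)_l = ⨁_{p + q = l} P_p ⊗_R X_q` with
`d(a ⊗ x) = da ⊗ x + (-1)^p a ⊗ dx` for `a ∈ P_p`. -/
def tensorComplex (P : Cx Rᵐᵒᵖ) (X : Cx S) : Cx S :=
  HomologicalComplex.mapBifunctor P X (tensorBifunctor φ hφ) (ComplexShape.down ℤ)

/-- The index set of the factors of `Hom_R(P, X)_l`: the pairs `(p, q)` with `p + l = q`. -/
abbrev HomIndex (l : ℤ) := {a : ℤ × ℤ // a.1 + l = a.2}

/-- The degree `l` term `∏_p Hom_R(P_p, X_{p+l})` of the complex `Hom_R(P, X)`, where `S` acts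
by `(s f)(a) = s (f a)`. The factor `Hom_R(P_p, X_{p+l})` is indexed by the pair `(p, p + l)`. -/
def homX (P : Cx R) (X : Cx S) (l : ℤ) : ModuleCat.{u} S :=
  haveI := fun q => res_smulCommClass φ hφ (X.X q)
  ModuleCat.of S (∀ a : HomIndex l, (P.X a.1.1 →ₗ[R] res φ (X.X a.1.2)))

/-- The differential of `Hom_R(P, X)`: for `f = (f_p)` of degree `l`,
`(d f)_p = d^X_{p+l} ∘ f_p - (-1)^l f_{p-1} ∘ d^P_p`. It is given as a map
`Hom_R(P, X)_i ⟶ Hom_R(P, X)_j`, which vanishes unless `j = i - 1`. -/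
def homD (P : Cx R) (X : Cx S) (i j : ℤ) : homX φ hφ P X i ⟶ homX φ hφ P X j :=
  haveI := fun q => res_smulCommClass φ hφ (X.X q)
  ModuleCat.ofHom
    (X := ∀ a : HomIndex i, (P.X a.1.1 →ₗ[R] res φ (X.X a.1.2)))
    (Y := ∀ a : HomIndex j, (P.X a.1.1 →ₗ[R] res φ (X.X a.1.2)))
    { toFun := fun f a =>
        ((ModuleCat.restrictScalars φ).map (X.d (a.1.1 + i) a.1.2)).hom ∘ₗ
            f ⟨(a.1.1, a.1.1 + i), rfl⟩ -
          i.negOnePow • (f ⟨(a.1.2 - i, a.1.2), sub_add_cancel _ _⟩ ∘ₗ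
            (P.d a.1.1 (a.1.2 - i)).hom)
      map_add' := fun f g => by
        ext a x
        simp only [Pi.add_apply, LinearMap.sub_apply, LinearMap.comp_apply, LinearMap.add_apply,
          LinearMap.smul_apply, Units.smul_def, map_add, smul_add]
        abel
      map_smul' := fun s f => by
        ext a x
        refine Eq.trans ?_ (smul_sub s
          (show X.X a.1.2 from (X.d (a.1.1 + i) a.1.2).hom (f ⟨(a.1.1, a.1.1 + i), rfl⟩ x))
          (i.negOnePow • (show X.X a.1.2 from
            f ⟨(a.1.2 - i, a.1.2), sub_add_cancel _ _⟩ ((P.d a.1.1 (a.1.2 - i)).hom x)))).symm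
        refine congrArg₂ (fun y z : X.X a.1.2 => y - z) ((X.d _ _).hom.map_smul s _) ?_
        exact smul_comm i.negOnePow s (show X.X a.1.2 from _) }

theorem homD_apply (P : Cx R) (X : Cx S) (i j : ℤ)
    (f : ∀ a : HomIndex i, (P.X a.1.1 →ₗ[R] res φ (X.X a.1.2))) (a : HomIndex j)
    (x : P.X a.1.1) :
    (show ∀ a : HomIndex j, (P.X a.1.1 →ₗ[R] res φ (X.X a.1.2)) from
        (homD φ hφ P X i j).hom f) a x =
      (show X.X a.1.2 from (X.d (a.1.1 + i) a.1.2).hom (f ⟨(a.1.1, a.1.1 + i), rfl⟩ x)) -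
        i.negOnePow • (show X.X a.1.2 from
          f ⟨(a.1.2 - i, a.1.2), sub_add_cancel _ _⟩ ((P.d a.1.1 (a.1.2 - i)).hom x)) := rfl

/-- The complex of left `S`-modules `Hom_R(P, X)`. -/
def homComplex (P : Cx R) (X : Cx S) : Cx S where
  X := homX φ hφ P X
  d := homD φ hφ P X
  shape i j hij := by
    ext f
    refine funext fun a => LinearMap.ext fun x => ?_
    obtain ⟨⟨p, q⟩, h⟩ := a
    refine (homD_apply φ hφ P X i j f _ x).trans ?_
    have hij' : j + 1 ≠ i := hij
    dsimp only at h ⊢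
    have h1 : X.d (p + i) q = 0 := X.shape _ _ (by change q + 1 ≠ p + i; lia)
    have h2 : P.d p (q - i) = 0 := P.shape _ _ (by change q - i + 1 ≠ p; lia)
    rw [h1, h2]
    refine (congrArg (fun y : X.X q => (0 : X.X q) - i.negOnePow • y)
      (LinearMap.map_zero (f ⟨(q - i, q), sub_add_cancel _ _⟩))).trans ?_
    exact (congrArg (fun y : X.X q => (0 : X.X q) - y) (smul_zero i.negOnePow)).trans (sub_zero _)
  d_comp_d' i j k hij hjk := by
    ext f
    refine funext fun a => LinearMap.ext fun x => ?_
    obtain ⟨⟨p, q⟩, h⟩ := a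
    have hij' : j + 1 = i := hij
    have hjk' : k + 1 = j := hjk
    dsimp only at h
    let F : HomIndex i → X.X q := fun b => (X.d b.1.2 q).hom (f b ((P.d p b.1.1).hom x))
    have hF : F ⟨(p + j - i, p + j), sub_add_cancel _ _⟩ = F ⟨(q - j, q - j + i), rfl⟩ :=
      congrArg F (Subtype.ext (Prod.ext (by dsimp only; lia) (by dsimp only; lia)))
    have e1 (y : X.X (p + i)) : (X.d (p + j) q).hom ((X.d (p + i) (p + j)).hom y) = 0 :=
      congrArg (fun g => g.hom y) (X.d_comp_d (p + i) (p + j) q)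
    have e2 : (P.d (q - j) (q - i)).hom ((P.d p (q - j)).hom x) = 0 :=
      congrArg (fun g => g.hom x) (P.d_comp_d p (q - j) (q - i))
    have hs : (j.negOnePow : ℤˣ) = -i.negOnePow := by
      rw [← hij', Int.negOnePow_succ, neg_neg]
    have key (y : X.X (p + i)) (y₁ : X.X (p + j)) (y₂ : X.X (q - j + i)) (y₃ : X.X q)
        (h₁ : (X.d (p + j) q).hom y₁ = (X.d (q - j + i) q).hom y₂) (h₃ : y₃ = 0) :
        (X.d (p + j) q).hom ((X.d (p + i) (p + j)).hom y - i.negOnePow • y₁) -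
          j.negOnePow • ((X.d (q - j + i) q).hom y₂ - i.negOnePow • y₃) = 0 := by
      rw [h₃, map_sub, e1, hs, smul_zero, sub_zero, zero_sub, Units.smul_def, Units.smul_def,
        map_zsmul, h₁, Units.val_neg, neg_smul, sub_neg_eq_add, neg_add_cancel]
    refine (homD_apply φ hφ P X j k _ _ x).trans (key _ _ _ _ hF ?_)
    exact (congrArg (f ⟨(q - i, q), sub_add_cancel _ _⟩) e2).trans (LinearMap.map_zero _)

/-- `Y` represents `RHom_R(U, X)`: it is quasi-isomorphic to `Hom_R(P, X)` for a DG-projective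
resolution `P ⟶ U` over `R`. -/
def IsRHom (U : Cx R) (X Y : Cx S) : Prop :=
  ∃ (P : Cx R) (π : P ⟶ U), IsDGProjectiveResolution π ∧
    QuasiIsomorphic (homComplex φ hφ P X) Y

/-- `Y` represents `U ⊗ᴸ_R X`: it is quasi-isomorphic to `P ⊗_R X` for a DG-projective
resolution `P ⟶ U` of the complex `U` of right `R`-modules. -/
def IsLTensor (U : Cx Rᵐᵒᵖ) (X Y : Cx S) : Prop :=
  ∃ (P : Cx Rᵐᵒᵖ) (π : P ⟶ U), IsDGProjectiveResolution π ∧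
    QuasiIsomorphic (tensorComplex φ hφ P X) Y

end Functors

end DingProj

end

noncomputable section

namespace DingProj

open Limits

/-! ### Exactness, quasi-isomorphisms and DG-projective complexes in terms of elements. -/

section Basics

variable {R : Type u} [Ring R]

/-! Replace `U` by a bounded complex `L` of projectives: in (1), finitely generated ones vanishing
below `inf U`, obtained by truncating at `inf U`; in (2), ones vanishing above `pd U`. Such an `L`
is DG-projective, hence homotopy equivalent to whichever resolution computes the derived functor. It
therefore suffices to apply `Φ = Hom_R(L, -)` or `Φ = L ⊗_R -` to an `𝓕`-complete resolution `T ⟶ P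
⟶ X` and to see that the result is again one, bijective from degree `n + b` on, where `b` is the top
column of `Φ`: `-inf U` or `pd U`.

Both functors are degreewise finite sums of columns `F_p(X_{l-p})` with triangular differential
(`TriangularFunctor`). For projective `A`, a dual basis makes `A ⊗_R -` a natural summand of a power
`M ↦ M^(I)`; the same holds for `Hom_R(A, -)` if `A` is also finitely generated
(`isRetractOfPower_tensor`, `isRetractOfPower_hom`). Centrality of the image of `φ` makes the
comparison maps `S`-linear.

Summands of powers preserve projectivity, exactness of mapping cones, and the property that all maps
into a given complex are null-homotopic, since maps out of `K^(I)` are families of maps out of `K`.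
The test complex thus stays fixed, and no flat module has to be transformed. Removing one column at
a time carries these properties over to `Φ` (`coneExact_map`, `orth_of_column`). DG-projectivity and
total `𝓕`-acyclicity are both, besides projectivity of the terms and, for the latter, exactness,
instances of the null-homotopy property: the targets are exact complexes, respectively flat modules
in one degree.

If `U` is exact, then so is the derived functor, and its Ding projective dimension is `-∞`. -/

theorem exactAt_iff_forall {K : Cx R} (i j k : ℤ) (hij : j + 1 = i) (hik : i + 1 = k) :
    K.ExactAt i ↔ ∀ x : K.X i, (K.d i j).hom x = 0 → ∃ y : K.X k, (K.d k i).hom y = x := by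
  rw [K.exactAt_iff' k i j (by simp [← hik]) (by simp [← hij]), ShortComplex.moduleCat_exact_iff]
  rfl

/-- Elementwise acyclicity of the mapping cone of `g`. -/
def ConeExact {K L : Cx R} (g : K ⟶ L) : Prop :=
  ∀ i j k : ℤ, j + 1 = i → i + 1 = k → ∀ (y : K.X j) (x : L.X i),
    (∀ l, (K.d j l).hom y = 0) → (g.f j).hom y = (L.d i j).hom x →
      ∃ (w : K.X i) (z : L.X k), (K.d i j).hom w = y ∧ x = (g.f i).hom w + (L.d k i).hom z

theorem d_d_apply (K : Cx R) (i j k : ℤ) (x : K.X i) : (K.d j k).hom ((K.d i j).hom x) = 0 :=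
  congrArg (fun f => f.hom x) (K.d_comp_d i j k)

theorem hom_d_apply {K L : Cx R} (g : K ⟶ L) (i j : ℤ) (x : K.X i) :
    (g.f j).hom ((K.d i j).hom x) = (L.d i j).hom ((g.f i).hom x) :=
  congrArg (fun f => f.hom x) (g.comm i j).symm

theorem d_eq_zero_of_d_pred {K : Cx R} {j : ℤ} {y : K.X j}
    (h : (K.d j (j - 1)).hom y = 0) (l : ℤ) : (K.d j l).hom y = 0 := by
  by_cases hl : l + 1 = j
  · obtain rfl : l = j - 1 := by lia
    exact h
  · rw [K.shape _ _ hl]; rfl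

/-- The cone of the zero map is a sum of `K` and a shift of `K`. One preservation result for exact
cones then covers acyclic complexes as well as quasi-isomorphisms. -/
theorem acyclic_iff_coneExact_zero {K : Cx R} : K.Acyclic ↔ ConeExact (0 : K ⟶ K) := by
  constructor
  · rintro h i j k hij hik y x hy hx
    obtain ⟨w, hw⟩ := (exactAt_iff_forall j (j - 1) i (by lia) hij).1 (h j) y (hy _)
    obtain ⟨z, hz⟩ := (exactAt_iff_forall i j k hij hik).1 (h i) x hx.symm
    exact ⟨w, z, hw, by rw [hz]; exact (zero_add x).symm⟩
  · intro h i
    refine (exactAt_iff_forall i (i - 1) (i + 1) (by lia) rfl).2 fun x hx => ?_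
    obtain ⟨w, z, -, hz⟩ := h i (i - 1) (i + 1) (by lia) rfl 0 x (fun _ => map_zero _) hx.symm
    exact ⟨z, by rw [hz]; exact (zero_add _).symm⟩

/-- A morphism from `R` to `M` picking out an element. -/
abbrev elt {M : ModuleCat.{u} R} (x : M) : ModuleCat.of R R ⟶ M :=
  ModuleCat.ofHom (LinearMap.toSpanSingleton R M x)

theorem elt_comp {M N : ModuleCat.{u} R} (x : M) (f : M ⟶ N) : elt x ≫ f = elt (f.hom x) := by
  ext; simp

theorem elt_inj {M : ModuleCat.{u} R} {x y : M} (h : elt x = elt y) : x = y := by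
  simpa using congrArg (fun f => f.hom 1) h

/-- The morphism from the free module on `A` to `M` extending a function `A → M`. -/
abbrev freeDesc {A : ModuleCat.{u} R} {M : ModuleCat.{u} R} (f : A → M) :
    ModuleCat.of R (A →₀ R) ⟶ M :=
  ModuleCat.ofHom (Finsupp.linearCombination R f)

theorem freeDesc_ext {A M : ModuleCat.{u} R} {f g : ModuleCat.of R (A →₀ R) ⟶ M}
    (h : ∀ a, f.hom (Finsupp.single a 1) = g.hom (Finsupp.single a 1)) : f = g := by
  ext a
  exact h a

theorem freeDesc_single {A M : ModuleCat.{u} R} (f : A → M) (a : A) :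
    (freeDesc f).hom (Finsupp.single a 1) = f a := by
  simp

theorem epi_freeDesc_id (A : ModuleCat.{u} R) : Epi (freeDesc (fun a : A => a)) := by
  rw [ModuleCat.epi_iff_surjective]
  exact fun a => ⟨Finsupp.single a 1, freeDesc_single _ _⟩

/-- Translates the criterion up to refinements. An element is a map from `R`, and a preimage of `1`
under the refining epimorphism recovers an elementwise solution; conversely, solutions chosen
element by element assemble to a map from the free module on the underlying set of `A`. -/
theorem mono_homologyMap_iff_forall {K L : Cx R} (g : K ⟶ L) (i j k : ℤ)
    (hij : j + 1 = i) (hik : i + 1 = k) :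
    Mono (HomologicalComplex.homologyMap g i) ↔ ∀ (x : K.X i) (y : L.X k),
      (K.d i j).hom x = 0 → (g.f i).hom x = (L.d k i).hom y → ∃ z : K.X k, x = (K.d k i).hom z := by
  rw [HomologicalComplex.mono_homologyMap_iff_up_to_refinements g k i j (by simp [← hik])
    (by simp [← hij])]
  constructor
  · intro h x y hx hy
    obtain ⟨A, p, hp, z, hz⟩ := h (elt x) (by rw [elt_comp, hx]; ext; simp) (elt y)
      (by rw [elt_comp, elt_comp, hy])
    rw [ModuleCat.epi_iff_surjective] at hp
    obtain ⟨a, ha⟩ := hp 1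
    refine ⟨z.hom a, ?_⟩
    have := congrArg (fun f => f.hom a) hz
    simpa [ha] using this
  · intro h A x hx y hy
    have H (a : A) := h (x.hom a) (y.hom a) (congrArg (fun f => f.hom a) hx)
      (congrArg (fun f => f.hom a) hy)
    choose z hz using H
    refine ⟨_, _, epi_freeDesc_id A, freeDesc z, freeDesc_ext fun a => ?_⟩
    simp [hz]

theorem epi_homologyMap_iff_forall {K L : Cx R} (g : K ⟶ L) (i j k : ℤ)
    (hij : j + 1 = i) (hik : i + 1 = k) :
    Epi (HomologicalComplex.homologyMap g i) ↔ ∀ (y : L.X i), (L.d i j).hom y = 0 →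
      ∃ (x : K.X i) (z : L.X k), (K.d i j).hom x = 0 ∧ y = (g.f i).hom x + (L.d k i).hom z := by
  rw [HomologicalComplex.epi_homologyMap_iff_up_to_refinements g k i j (by simp [← hik])
    (by simp [← hij])]
  constructor
  · intro h y hy
    obtain ⟨A, p, hp, x, hx, z, hz⟩ := h (elt y) (by rw [elt_comp, hy]; ext; simp)
    rw [ModuleCat.epi_iff_surjective] at hp
    obtain ⟨a, ha⟩ := hp 1
    refine ⟨x.hom a, z.hom a, congrArg (fun f => f.hom a) hx, ?_⟩
    have := congrArg (fun f => f.hom a) hz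
    simpa [ha] using this
  · intro h A y hy
    have H (a : A) := h (y.hom a) (congrArg (fun f => f.hom a) hy)
    choose x z hx hz using H
    refine ⟨_, _, epi_freeDesc_id A, freeDesc x, freeDesc_ext fun a => ?_, freeDesc z,
      freeDesc_ext fun a => ?_⟩
    · simp [hx]
    · simp [← hz]

/-- Exactness of the cone in one degree mixes injectivity on `H_j` (to write `y` as a boundary) with
surjectivity on `H_i` (to correct the remaining cycle). -/
theorem quasiIso_iff_coneExact {K L : Cx R} (g : K ⟶ L) : QuasiIso g ↔ ConeExact g := by
  have key : QuasiIso g ↔ ∀ i, Mono (HomologicalComplex.homologyMap g i) ∧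
      Epi (HomologicalComplex.homologyMap g i) := by
    rw [quasiIso_iff]
    refine forall_congr' fun i => ?_
    rw [quasiIsoAt_iff_isIso_homologyMap]
    exact ⟨fun h => ⟨inferInstance, inferInstance⟩, fun ⟨_, _⟩ => isIso_of_mono_of_epi _⟩
  rw [key]
  constructor
  · rintro h i j k hij hik y x hy hx
    obtain ⟨w, hw⟩ := (mono_homologyMap_iff_forall g j (j - 1) i (by lia) hij).1 (h j).1 y x
      (hy _) hx
    obtain ⟨c, z, hc, hz⟩ := (epi_homologyMap_iff_forall g i j k hij hik).1 (h i).2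
      (x - (g.f i).hom w) (by rw [map_sub, ← hom_d_apply, ← hw, hx, sub_self])
    refine ⟨w + c, z, by rw [map_add, hc, ← hw, add_zero], ?_⟩
    rw [map_add, add_assoc, ← hz]; abel
  · intro h i
    constructor
    · refine (mono_homologyMap_iff_forall g i (i - 1) (i + 1) (by lia) rfl).2 fun x y hx hy => ?_
      obtain ⟨w, -, hw, -⟩ := h (i + 1) i (i + 2) rfl (by lia) x y (d_eq_zero_of_d_pred hx) hy
      exact ⟨w, hw.symm⟩
    · refine (epi_homologyMap_iff_forall g i (i - 1) (i + 1) (by lia) rfl).2 fun y hy => ?_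
      obtain ⟨w, z, hw, hz⟩ := h i (i - 1) (i + 1) (by lia) rfl 0 y (fun _ => map_zero _)
        (by rw [hy, map_zero])
      exact ⟨w, z, hw, hz⟩

/-- Every morphism `K ⟶ E` is null-homotopic. -/
def Orth (K E : Cx R) : Prop := ∀ f : K ⟶ E, Nonempty (Homotopy f 0)

/-- The family `h` is free of any shape condition, since only its entries of degree one matter. It
can therefore be built by choice or updated entry by entry. -/
theorem nonempty_homotopy_zero_iff {K E : Cx R} (f : K ⟶ E) :
    Nonempty (Homotopy f 0) ↔ ∃ h : ∀ i j : ℤ, K.X i ⟶ E.X j, ∀ i j k, j + 1 = i → i + 1 = k →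
      f.f i = K.d i j ≫ h j i + h i k ≫ E.d k i := by
  constructor
  · rintro ⟨h⟩
    refine ⟨h.hom, fun i j k hij hik => ?_⟩
    rw [h.comm i, dNext_eq _ (show (ComplexShape.down ℤ).Rel i j from hij),
      prevD_eq _ (show (ComplexShape.down ℤ).Rel k i from hik)]
    simp
  · rintro ⟨h, hh⟩
    have e : f = Homotopy.nullHomotopicMap' (fun i j _ => h i j) := by
      ext1 i
      rw [Homotopy.nullHomotopicMap'_f (show (ComplexShape.down ℤ).Rel (i + 1) i from rfl)
        (show (ComplexShape.down ℤ).Rel i (i - 1) by simp), ← hh _ _ _ (by lia) rfl]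
    rw [e]
    exact ⟨Homotopy.nullHomotopy' _⟩

theorem nonempty_homotopy_iff {K E : Cx R} (f g : K ⟶ E) :
    Nonempty (Homotopy f g) ↔ Nonempty (Homotopy (f - g) 0) :=
  ⟨fun ⟨h⟩ => ⟨Homotopy.equivSubZero h⟩, fun ⟨h⟩ => ⟨Homotopy.equivSubZero.symm h⟩⟩

theorem quasiIso_of_homotopy {K L : Cx R} {f g : K ⟶ L} (h : Homotopy f g) (hf : QuasiIso f) :
    QuasiIso g := by
  rw [quasiIso_iff] at hf ⊢
  intro i
  have := hf i
  rw [quasiIsoAt_iff_isIso_homologyMap] at this ⊢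
  rwa [← h.homologyMap_eq i]

open HomologicalComplex in
theorem acyclic_homotopyCofiber [DecidableRel (ComplexShape.down ℤ).Rel] {K L : Cx R} (g : K ⟶ L)
    (hg : QuasiIso g) : (homotopyCofiber g).Acyclic := by
  rw [quasiIso_iff_coneExact] at hg
  intro i
  have r {i j : ℤ} (h : j + 1 = i) : (ComplexShape.down ℤ).Rel i j := h
  refine (exactAt_iff_forall i (i - 1) (i + 1) (by lia) rfl).2 fun x hx => ?_
  have h1 (l : ℤ) (hl : l + 1 = i - 1) := congrArg (fun f => f.hom x)
    (homotopyCofiber.d_fstX g i (i - 1) l (r (by lia)) (r hl))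
  have h2 := congrArg (fun f => f.hom x) (homotopyCofiber.d_sndX g i (i - 1) (r (by lia)))
  change (homotopyCofiber.d g i (i - 1)).hom x = 0 at hx
  simp only [ModuleCat.hom_comp, LinearMap.comp_apply, hx, map_zero, ModuleCat.hom_add,
    LinearMap.add_apply, ModuleCat.hom_neg, LinearMap.neg_apply] at h1 h2
  -- With components `(a, b)`, a cycle of the cofiber satisfies `da = 0` and `g a + db = 0`;
  -- negating `b` matches the sign convention of `ConeExact`.
  obtain ⟨w, z, hw, hz⟩ := hg i (i - 1) (i + 1) (by lia) rfl
    ((homotopyCofiber.fstX g i (i - 1) (r (by lia))).hom x) (-(homotopyCofiber.sndX g i).hom x)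
    (d_eq_zero_of_d_pred (by have := h1 (i - 1 - 1) (by lia); simpa using this.symm))
    (by rw [map_neg]; exact eq_neg_of_add_eq_zero_left h2.symm)
  refine ⟨(homotopyCofiber.inlX g i (i + 1) (r rfl)).hom (-w) +
    (homotopyCofiber.inrX g (i + 1)).hom (-z), ?_⟩
  apply elt_inj
  have e1 := congrArg (fun f => f.hom w)
    (homotopyCofiber.inlX_d g (i + 1) i (i - 1) (r rfl) (r (by lia)))
  have e2 := congrArg (fun f => f.hom z) (homotopyCofiber.inrX_d g (i + 1) i)
  change elt ((homotopyCofiber.d g (i + 1) i).hom _) = _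
  simp only [ModuleCat.hom_comp, LinearMap.comp_apply, ModuleCat.hom_add,
    LinearMap.add_apply, ModuleCat.hom_neg, LinearMap.neg_apply] at e1 e2
  rw [map_add, map_neg, map_neg, map_neg, map_neg, e1, e2, hw]
  apply homotopyCofiber.ext_to_X g i (i - 1) (r (by lia))
  · have e3 := congrArg (fun f => f.hom ((K.d i (i - 1)).hom w))
      (homotopyCofiber.inlX_fstX g (i - 1) i (r (by lia)))
    have e4 (y) := congrArg (fun f => f.hom y) (homotopyCofiber.inrX_fstX g i (i - 1) (r (by lia)))
    simp only [ModuleCat.hom_comp, LinearMap.comp_apply, hw] at e3 e4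
    rw [elt_comp, elt_comp]
    congr 1
    simp only [map_add, map_neg, e3, e4]
    simp
  · have e3 := congrArg (fun f => f.hom ((K.d i (i - 1)).hom w))
      (homotopyCofiber.inlX_sndX g (i - 1) i (r (by lia)))
    have e4 (y) := congrArg (fun f => f.hom y) (homotopyCofiber.inrX_sndX g i)
    simp only [ModuleCat.hom_comp, LinearMap.comp_apply, hw] at e3 e4
    rw [elt_comp, elt_comp]
    congr 1
    simp only [map_add, map_neg, e3, e4]
    simp only [ModuleCat.hom_zero, LinearMap.zero_apply, ModuleCat.hom_id, LinearMap.id_apply]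
    refine Eq.trans ?_ (neg_eq_iff_eq_neg.1 hz).symm
    abel

open HomologicalComplex in
-- The composite of `f` with the inclusion into the acyclic cone of `g` is null-homotopic. The first
-- component of a null-homotopy is the lift `f'`, the second is the homotopy from `f` to `f' ≫ g`.
theorem IsDGProjective.exists_lift {P K L : Cx R} (hP : IsDGProjective P) (g : K ⟶ L)
    (hg : QuasiIso g) (f : P ⟶ L) : ∃ f' : P ⟶ K, Nonempty (Homotopy f (f' ≫ g)) := by
  classical
  have r {i j : ℤ} (h : j + 1 = i) : (ComplexShape.down ℤ).Rel i j := h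
  obtain ⟨h, hh⟩ := (nonempty_homotopy_zero_iff _).1
    (hP.homotopy_zero _ (acyclic_homotopyCofiber g hg) (f ≫ homotopyCofiber.inr g))
  simp only [comp_f, homotopyCofiber.inr_f, homotopyCofiber_d] at hh
  let f' : P ⟶ K :=
    { f := fun i => h i (i + 1) ≫ homotopyCofiber.fstX g (i + 1) i (r rfl)
      comm' := fun i j hij => by
        have hij' : j + 1 = i := hij
        subst hij'
        have := congrArg (fun u => u ≫ homotopyCofiber.fstX g (j + 1) j (r rfl))
          (hh (j + 1) j (j + 1 + 1) rfl rfl)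
        simp only [Category.assoc, homotopyCofiber.inrX_fstX, comp_zero, Preadditive.add_comp,
          homotopyCofiber.d_fstX g (j + 1 + 1) (j + 1) j (r rfl) (r rfl), Preadditive.comp_neg] at this
        simp only [Category.assoc]
        exact (neg_add_eq_zero.1 ((add_comm _ _).trans this.symm)) }
  refine ⟨f', (nonempty_homotopy_iff _ _).2 ((nonempty_homotopy_zero_iff _).2
    ⟨fun i j => h i j ≫ homotopyCofiber.sndX g j, fun i j k hij hik => ?_⟩)⟩
  subst hik
  have := congrArg (fun u => u ≫ homotopyCofiber.sndX g i) (hh i j (i + 1) hij rfl)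
  simp only [Category.assoc, homotopyCofiber.inrX_sndX, Category.comp_id, Preadditive.add_comp,
    homotopyCofiber.d_sndX g (i + 1) i (r rfl), Preadditive.comp_add] at this
  simp only [sub_f_apply, comp_f, f', Category.assoc]
  rw [this]
  abel

/-- Induction along the zigzag: forward arrows are composed with, backward arrows are lifted
through. -/
theorem IsDGProjective.exists_quasiIso_iff {P : Cx R} (hP : IsDGProjective P) {X Y : Cx R}
    (h : QuasiIsomorphic X Y) : (∃ f : P ⟶ X, QuasiIso f) ↔ ∃ f : P ⟶ Y, QuasiIso f := by
  induction h with
  | rel K L h =>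
    obtain ⟨g, hg⟩ := h
    constructor
    · rintro ⟨f, hf⟩
      exact ⟨f ≫ g, inferInstance⟩
    · rintro ⟨f, hf⟩
      obtain ⟨f', ⟨h'⟩⟩ := hP.exists_lift g hg f
      have := quasiIso_of_homotopy h' hf
      exact ⟨f', quasiIso_of_comp_right f' g⟩
  | refl => rfl
  | symm _ _ _ ih => exact ih.symm
  | trans _ _ _ _ _ h1 h2 => exact h1.trans h2

/-- A DG-projective complex quasi-isomorphic to `X` is a resolution of `X`. -/
theorem IsDGProjective.exists_quasiIso {P X : Cx R} (hP : IsDGProjective P)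
    (h : QuasiIsomorphic P X) : ∃ f : P ⟶ X, QuasiIso f :=
  (hP.exists_quasiIso_iff h).1 ⟨𝟙 P, inferInstance⟩

/-- Lifting the identity gives `g` with `g ≫ f ∼ 𝟙`. Then `g` is a quasi-isomorphism too and has its
own `f'` with `f' ≫ g ∼ 𝟙`; hence `f' ∼ f' ≫ g ≫ f ∼ f`. -/
theorem nonempty_homotopyEquiv_of_quasiIso {P Q : Cx R} (hP : IsDGProjective P)
    (hQ : IsDGProjective Q) (f : P ⟶ Q) (hf : QuasiIso f) : Nonempty (HomotopyEquiv P Q) := by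
  obtain ⟨g, ⟨h⟩⟩ := hQ.exists_lift f hf (𝟙 Q)
  have hg : QuasiIso g := by
    have := quasiIso_of_homotopy h inferInstance
    exact quasiIso_of_comp_right g f
  obtain ⟨f', ⟨h'⟩⟩ := hP.exists_lift g hg (𝟙 P)
  have e : Homotopy f' f :=
    (Homotopy.ofEq (Category.comp_id f').symm).trans
      ((h.compLeft f').trans ((Homotopy.ofEq (Category.assoc f' g f).symm).trans
        ((h'.symm.compRight f).trans (Homotopy.ofEq (Category.id_comp f)))))
  exact ⟨⟨f, g, (e.symm.compRight g).trans h'.symm, h.symm⟩⟩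

theorem IsDGProjectiveResolution.nonempty_homotopyEquiv {P Q U : Cx R} {π : P ⟶ U}
    (hπ : IsDGProjectiveResolution π) (hQ : IsDGProjective Q) (h : QuasiIsomorphic Q U) :
    Nonempty (HomotopyEquiv Q P) := by
  obtain ⟨f, hf⟩ := hQ.exists_quasiIso
    (h.trans _ _ _ (.symm _ _ (.rel _ _ ⟨π, hπ.quasiIso⟩)))
  exact nonempty_homotopyEquiv_of_quasiIso hQ hπ.dgProjective f hf

theorem QuasiIsomorphic.exactAt_iff {X Y : Cx R} (h : QuasiIsomorphic X Y) (i : ℤ) :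
    X.ExactAt i ↔ Y.ExactAt i := by
  induction h with
  | rel K L h =>
    obtain ⟨g, hg⟩ := h
    exact exactAt_iff_of_quasiIsoAt g i
  | refl => rfl
  | symm _ _ _ ih => exact ih.symm
  | trans _ _ _ _ _ h1 h2 => exact h1.trans h2

theorem QuasiIsomorphic.of_homotopyEquiv {X Y : Cx R} (e : HomotopyEquiv X Y) :
    QuasiIsomorphic X Y :=
  .rel _ _ ⟨e.hom, inferInstance⟩

/-- `dpd` is bounded by `n` as soon as `X` is quasi-isomorphic to a complex with a suitable
`𝓕`-complete resolution. -/
theorem dpd_le_of_quasiIsomorphic {X Y : Cx R} (h : QuasiIsomorphic X Y)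
    (C : FCompleteResolution X) (n : ℤ) (hn : ∀ i ≥ n, Function.Bijective (C.τ.f i)) :
    dpd Y ≤ ((n : ℝ) : EReal) := by
  obtain ⟨f, hf⟩ := C.resolution.dgProjective.exists_quasiIso
    (.trans _ _ _ (.rel _ _ ⟨C.π, C.resolution.quasiIso⟩) h)
  exact sInf_le ⟨n, rfl, ⟨C.T, C.P, C.τ, f, ⟨C.resolution.dgProjective, hf⟩, C.totallyAcyclic,
    ⟨n, hn⟩⟩, hn⟩

end Basics

/-! ### Triangular functors: passing from columns to the whole complex. -/

section Triangular

variable {S : Type u} [Ring S]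

/-- The complex `E` shifted by `m` places, with differential multiplied by `ε`. -/
def signShift (m : ℤ) (ε : ℤˣ) (E : Cx S) : Cx S where
  X q := E.X (m + q)
  d i j := ε • E.d (m + i) (m + j)
  shape i j hij := by
    rw [E.shape, smul_zero]
    intro h
    have h' : m + j + 1 = m + i := h
    exact hij (show j + 1 = i by lia)
  d_comp_d' i j k _ _ := by
    rw [Linear.units_smul_comp, Linear.comp_units_smul, E.d_comp_d, smul_zero, smul_zero]

theorem acyclic_signShift {E : Cx S} (hE : E.Acyclic) (m : ℤ) (ε : ℤˣ) :
    (signShift m ε E).Acyclic := by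
  intro i
  refine (exactAt_iff_forall i (i - 1) (i + 1) (by lia) rfl).2 fun x hx => ?_
  have hx' : ε • (E.d (m + i) (m + (i - 1))).hom x = 0 := hx
  obtain ⟨y, hy⟩ := (exactAt_iff_forall (m + i) (m + (i - 1)) (m + (i + 1)) (by lia) (by lia)).1
    (hE (m + i)) x ((smul_eq_zero_iff_eq ε).1 hx')
  refine ⟨ε • y, ?_⟩
  change ε • (E.d (m + (i + 1)) (m + i)).hom (ε • y) = x
  rw [Units.smul_def, Units.smul_def, map_zsmul, ← Units.smul_def, ← Units.smul_def, smul_smul,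
    Int.units_mul_self, one_smul, hy]

/-- A functor on complexes whose values are, degreewise, finite sums
`Φ(X)_l = ⨁_{a ≤ p ≤ b} F_p(X_{l-p})`, with triangular differential whose diagonal
components are `± F_p(d)`. -/
structure TriangularFunctor (S : Type u) [Ring S] where
  obj : Cx S → Cx S
  map : ∀ {X Y : Cx S}, (X ⟶ Y) → (obj X ⟶ obj Y)
  F : ℤ → ModuleCat.{u} S ⥤ ModuleCat.{u} S
  additive : ∀ p, (F p).Additive
  sign : ℤ → ℤˣ
  a : ℤ
  b : ℤ
  ι : ∀ (X : Cx S) (p q l : ℤ), p + q = l → ((F p).obj (X.X q) ⟶ (obj X).X l)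
  π : ∀ (X : Cx S) (p q l : ℤ), p + q = l → ((obj X).X l ⟶ (F p).obj (X.X q))
  ι_π : ∀ (X : Cx S) (p q l : ℤ) (h : p + q = l), ι X p q l h ≫ π X p q l h = 𝟙 _
  ι_π_of_ne : ∀ (X : Cx S) (p q p' q' l : ℤ) (h : p + q = l) (h' : p' + q' = l), p ≠ p' →
    ι X p q l h ≫ π X p' q' l h' = 0
  sum_π_ι : ∀ (X : Cx S) (l : ℤ),
    ∑ p ∈ Finset.Icc a b, π X p (l - p) l (by lia) ≫ ι X p (l - p) l (by lia) = 𝟙 _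
  ι_map : ∀ {X Y : Cx S} (g : X ⟶ Y) (p q l : ℤ) (h : p + q = l),
    ι X p q l h ≫ (map g).f l = (F p).map (g.f q) ≫ ι Y p q l h
  ι_d_π : ∀ (X : Cx S) (p q q' l l' : ℤ) (h : p + q = l) (h' : p + q' = l'),
    ι X p q l h ≫ (obj X).d l l' ≫ π X p q' l' h' = sign p • (F p).map (X.d q q')
  ι_d_π_of_lt : ∀ (X : Cx S) (p q p' q' l l' : ℤ) (h : p + q = l) (h' : p' + q' = l'), p < p' →
    ι X p q l h ≫ (obj X).d l l' ≫ π X p' q' l' h' = 0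

namespace TriangularFunctor

variable (Φ : TriangularFunctor S)

instance (p : ℤ) : (Φ.F p).Additive := Φ.additive p

/-- `F_p` applied degreewise. -/
abbrev column (p : ℤ) : Cx S ⥤ Cx S := (Φ.F p).mapHomologicalComplex _

variable {Φ}

theorem hom_ext_from {X : Cx S} {l : ℤ} {M : ModuleCat.{u} S} {f g : (Φ.obj X).X l ⟶ M}
    (h : ∀ p q (hpq : p + q = l), p ∈ Finset.Icc Φ.a Φ.b →
      Φ.ι X p q l hpq ≫ f = Φ.ι X p q l hpq ≫ g) : f = g := by
  rw [← Category.id_comp f, ← Category.id_comp g, ← Φ.sum_π_ι, Preadditive.sum_comp,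
    Preadditive.sum_comp]
  refine Finset.sum_congr rfl fun p hp => ?_
  rw [Category.assoc, Category.assoc, h p _ _ hp]

theorem map_π {X Y : Cx S} (g : X ⟶ Y) (p q l : ℤ) (h : p + q = l) :
    (Φ.map g).f l ≫ Φ.π Y p q l h = Φ.π X p q l h ≫ (Φ.F p).map (g.f q) := by
  refine hom_ext_from fun p' q' h' _ => ?_
  rw [← Category.assoc, Φ.ι_map, Category.assoc, ← Category.assoc (Φ.ι X p' q' l h')]
  by_cases hp : p' = p
  · subst hp
    obtain rfl : q = q' := by lia
    rw [Φ.ι_π, Φ.ι_π, Category.comp_id, Category.id_comp]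
  · rw [Φ.ι_π_of_ne _ _ _ _ _ _ _ _ hp, Φ.ι_π_of_ne _ _ _ _ _ _ _ _ hp, zero_comp, comp_zero]

theorem map_zero' (X Y : Cx S) : Φ.map (0 : X ⟶ Y) = 0 := by
  ext1 l
  refine hom_ext_from fun p q h _ => ?_
  rw [Φ.ι_map]
  simp

theorem ι_eq_zero (X : Cx S) (p q l : ℤ) (h : p + q = l) (hp : p ∉ Finset.Icc Φ.a Φ.b) :
    Φ.ι X p q l h = 0 := by
  rw [← Category.comp_id (Φ.ι X p q l h), ← Φ.sum_π_ι, Preadditive.comp_sum]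
  refine Finset.sum_eq_zero fun p' hp' => ?_
  rw [← Category.assoc, Φ.ι_π_of_ne _ _ _ _ _ _ _ _ (by rintro rfl; exact hp hp'), zero_comp]

theorem π_eq_zero (X : Cx S) (p q l : ℤ) (h : p + q = l) (hp : p ∉ Finset.Icc Φ.a Φ.b) :
    Φ.π X p q l h = 0 :=
  hom_ext_from fun p' q' h' hp' => by
    rw [Φ.ι_π_of_ne _ _ _ _ _ _ _ _ (by rintro rfl; exact hp hp'), comp_zero]

/-- If `f` vanishes on the columns below `m`, then it is compatible with the differential of
column `m`. -/
theorem ι_d {X : Cx S} {M : ModuleCat.{u} S} {l' : ℤ} (f : (Φ.obj X).X l' ⟶ M) (m : ℤ)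
    (hf : ∀ p q (h : p + q = l'), p < m → Φ.ι X p q l' h ≫ f = 0)
    (q q' l : ℤ) (h : m + q = l) (h' : m + q' = l') :
    Φ.ι X m q l h ≫ (Φ.obj X).d l l' ≫ f =
      Φ.sign m • (Φ.F m).map (X.d q q') ≫ Φ.ι X m q' l' h' ≫ f := by
  conv_lhs => rw [← Category.id_comp f, ← Φ.sum_π_ι, Preadditive.sum_comp, Preadditive.comp_sum,
    Preadditive.comp_sum]
  rw [Finset.sum_eq_single m]
  · obtain rfl : q' = l' - m := by lia
    rw [Category.assoc, ← Category.assoc _ (Φ.π X m (l' - m) l' _), ← Category.assoc, Φ.ι_d_π,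
      Linear.units_smul_comp]
  · intro p _ hp
    rcases lt_or_gt_of_ne hp with hp | hp
    · rw [Category.assoc, hf _ _ _ hp, comp_zero, comp_zero, comp_zero]
    · rw [Category.assoc, ← Category.assoc _ (Φ.π X p _ l' _), ← Category.assoc,
        Φ.ι_d_π_of_lt _ _ _ _ _ _ _ _ _ hp, zero_comp]
  · intro hm
    rw [Φ.ι_eq_zero _ _ _ _ _ hm, zero_comp]

/-- If `f` has no component in the columns above `m`, then its component in column `m` is
compatible with the differential. -/
theorem d_π {X : Cx S} {M : ModuleCat.{u} S} {l : ℤ} (f : M ⟶ (Φ.obj X).X l) (m : ℤ)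
    (hf : ∀ p q (h : p + q = l), m < p → f ≫ Φ.π X p q l h = 0)
    (q q' l' : ℤ) (h : m + q = l) (h' : m + q' = l') :
    f ≫ (Φ.obj X).d l l' ≫ Φ.π X m q' l' h' =
      Φ.sign m • (f ≫ Φ.π X m q l h) ≫ (Φ.F m).map (X.d q q') := by
  conv_lhs => rw [← Category.comp_id f, ← Φ.sum_π_ι, Preadditive.comp_sum, Preadditive.sum_comp]
  rw [Finset.sum_eq_single m]
  · obtain rfl : q = l - m := by lia
    rw [Category.assoc, Category.assoc, Φ.ι_d_π _ _ (l - m), Linear.comp_units_smul,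
      Linear.comp_units_smul, Category.assoc]
  · intro p _ hp
    rcases lt_or_gt_of_ne hp with hp | hp
    · rw [Category.assoc, Category.assoc, Φ.ι_d_π_of_lt _ _ _ _ _ _ _ _ _ hp, comp_zero, comp_zero]
    · rw [← Category.assoc f, hf _ _ _ hp, zero_comp, zero_comp]
  · intro hm
    rw [Φ.π_eq_zero _ _ _ _ _ hm, zero_comp, comp_zero, zero_comp]

theorem d_π_apply {X : Cx S} {l : ℤ} (x : (Φ.obj X).X l) (m : ℤ)
    (hx : ∀ p q (h : p + q = l), m < p → (Φ.π X p q l h).hom x = 0)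
    (q q' l' : ℤ) (h : m + q = l) (h' : m + q' = l') :
    (Φ.π X m q' l' h').hom (((Φ.obj X).d l l').hom x) =
      Φ.sign m • ((Φ.F m).map (X.d q q')).hom ((Φ.π X m q l h).hom x) := by
  have := Φ.d_π (elt x) m (fun p q h hp => by rw [elt_comp, hx p q h hp]; ext; simp) q q' l' h h'
  simpa using congrArg (fun f => f.hom (1 : S)) this

/-- The differential never raises the column index, so columns are removed from the bottom. A map
vanishing on the columns below `m` restricts to a chain map on column `m`, up to shift and sign; a
null-homotopy of it, extended by zero to the other columns, is subtracted. Column `m` sits `m`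
degrees higher in `Φ.obj X`, which is why `𝓔` must be stable under `signShift`. -/
theorem orth_of_column (𝓔 : Cx S → Prop)
    (h𝓔 : ∀ (m : ℤ) (ε : ℤˣ) (E : Cx S), 𝓔 E → 𝓔 (signShift m ε E)) (X : Cx S)
    (hX : ∀ (p : ℤ) (E : Cx S), 𝓔 E → Orth ((Φ.column p).obj X) E) (E : Cx S) (hE : 𝓔 E) :
    Orth (Φ.obj X) E := by
  intro f
  have key : ∀ n : ℕ, ∃ f' : Φ.obj X ⟶ E, Nonempty (Homotopy f f') ∧
      ∀ p q l (h : p + q = l), p < Φ.a + n → Φ.ι X p q l h ≫ f'.f l = 0 := by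
    intro n
    induction n with
    | zero =>
      refine ⟨f, ⟨Homotopy.refl f⟩, fun p q l h hp => ?_⟩
      rw [Φ.ι_eq_zero _ _ _ _ _ (fun hp' => by simp at hp' hp; lia), zero_comp]
    | succ n ih =>
      obtain ⟨f', ⟨hf'⟩, hzero⟩ := ih
      obtain ⟨m, hm⟩ : ∃ m : ℤ, m = Φ.a + n := ⟨_, rfl⟩
      rw [← hm] at hzero
      let v : (Φ.column m).obj X ⟶ signShift m (Φ.sign m) E :=
        { f := fun q => Φ.ι X m q (m + q) rfl ≫ f'.f (m + q)
          comm' := fun i j hij => by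
            change (Φ.ι X m i (m + i) rfl ≫ f'.f (m + i)) ≫ (Φ.sign m • E.d (m + i) (m + j)) =
              (Φ.F m).map (X.d i j) ≫ Φ.ι X m j (m + j) rfl ≫ f'.f (m + j)
            rw [Linear.comp_units_smul, Category.assoc, f'.comm,
              Φ.ι_d _ m (fun p q h hp => hzero p q _ h hp) i j _ rfl rfl, smul_smul,
              Int.units_mul_self, one_smul] }
      obtain ⟨h, hh⟩ := (nonempty_homotopy_zero_iff v).1 (hX m _ (h𝓔 m (Φ.sign m) E hE) v)
      -- Reindexes `h` by the actual degree in `E`, so that degrees no longer have to be of the form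
      -- `m + r`.
      obtain ⟨k, hk⟩ : ∃ k : ∀ q l : ℤ, (Φ.F m).obj (X.X q) ⟶ E.X l,
          ∀ q r, k q (m + r) = h q r := by
        refine ⟨fun q l => h q (l - m) ≫ (E.XIsoOfEq (show m + (l - m) = l by lia)).hom,
          fun q r => ?_⟩
        have aux (r' : ℤ) (e : r' = r) (e' : m + r' = m + r) :
            h q r' ≫ (E.XIsoOfEq e').hom = h q r := by
          subst e; exact Category.comp_id _
        exact aux _ (by lia) _
      have hh' (q q₁ q₂ : ℤ) (h₁ : q₁ + 1 = q) (h₂ : q + 1 = q₂) :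
          Φ.ι X m q (m + q) rfl ≫ f'.f (m + q) = (Φ.F m).map (X.d q q₁) ≫ k q₁ (m + q) +
            Φ.sign m • k q (m + q₂) ≫ E.d (m + q₂) (m + q) := by
        refine (hh q q₁ q₂ h₁ h₂).trans ?_
        rw [hk, hk]
        exact congrArg (fun t => (Φ.F m).map (X.d q q₁) ≫ h q₁ q + t)
          (Linear.comp_units_smul (h q q₂) (Φ.sign m) (E.d (m + q₂) (m + q)))
      -- Factoring through the projection to column `m` leaves the lower columns untouched, because
      -- the differential maps them to columns below `m`. The sign cancels the one on the diagonal
      -- of the differential.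
      let H : ∀ i j : ℤ, (ComplexShape.down ℤ).Rel j i → ((Φ.obj X).X i ⟶ E.X j) :=
        fun i j _ => Φ.sign m • Φ.π X m (i - m) i (by lia) ≫ k (i - m) j
      refine ⟨f' - Homotopy.nullHomotopicMap' H, ?_, ?_⟩
      · obtain ⟨e⟩ := (nonempty_homotopy_iff f' (f' - Homotopy.nullHomotopicMap' H)).2
          (by rw [sub_sub_cancel]; exact ⟨Homotopy.nullHomotopy' H⟩)
        exact ⟨hf'.trans e⟩
      · intro p q l hpq hp
        rw [HomologicalComplex.sub_f_apply,
          Homotopy.nullHomotopicMap'_f (show (ComplexShape.down ℤ).Rel (l + 1) l from rfl)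
            (show (ComplexShape.down ℤ).Rel l (l - 1) by simp)]
        simp only [H, Preadditive.comp_sub, Preadditive.comp_add, Linear.comp_units_smul,
          Linear.units_smul_comp, Category.assoc]
        rcases eq_or_lt_of_le (show p ≤ m by push_cast at hp; lia) with hpm | hp
        · subst hpm hpq
          rw [← Category.assoc _ (Φ.π X p _ (p + q - 1) _), ← Category.assoc, Φ.ι_d_π _ _ q,
            hh' q (p + q - 1 - p) (q + 1) (by lia) rfl, Linear.units_smul_comp, smul_smul,
            Int.units_mul_self, one_smul]
          have aux : ∀ (q' : ℤ) (e : q' = q) (l' : ℤ) (el : l' = p + q + 1) ,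
              Φ.ι X p q (p + q) rfl ≫ Φ.π X p q' (p + q) (by lia) ≫ k q' l' ≫ E.d l' (p + q) =
              k q (p + (q + 1)) ≫ E.d (p + (q + 1)) (p + q) := by
            intro r e l' el
            subst e
            obtain rfl : l' = p + (r + 1) := by lia
            rw [← Category.assoc, Φ.ι_π, Category.id_comp]
          rw [aux (p + q - p) (add_sub_cancel_left p q) (p + q + 1) rfl]
          abel
        · rw [hzero p q l hpq hp, ← Category.assoc _ (Φ.π X m _ (l - 1) _), ← Category.assoc,
            Φ.ι_d_π_of_lt _ _ _ _ _ _ _ _ _ hp, ← Category.assoc _ (Φ.π X m _ l _),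
            Φ.ι_π_of_ne _ _ _ _ _ _ _ _ hp.ne]
          simp
  obtain ⟨f', hf', hzero⟩ := key (Φ.b + 1 - Φ.a).toNat
  have : f' = 0 := by
    ext1 l
    refine hom_ext_from fun p q h hp => ?_
    rw [hzero _ _ _ _ (by rw [Finset.mem_Icc] at hp; lia)]
    simp
  rwa [this] at hf'

theorem eq_zero_of_π {X : Cx S} {l : ℤ} {x : (Φ.obj X).X l}
    (h : ∀ p q (hpq : p + q = l), p ∈ Finset.Icc Φ.a Φ.b → (Φ.π X p q l hpq).hom x = 0) :
    x = 0 := by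
  have := congrArg (fun f => f.hom x) (Φ.sum_π_ι X l)
  simp only [ModuleCat.hom_sum, LinearMap.sum_apply, ModuleCat.hom_comp, LinearMap.comp_apply,
    ModuleCat.hom_id, LinearMap.id_apply] at this
  rw [← this]
  refine Finset.sum_eq_zero fun p hp => ?_
  rw [h p _ _ hp, map_zero]

theorem map_π_apply {X Y : Cx S} (g : X ⟶ Y) (p q l : ℤ) (h : p + q = l) (x : (Φ.obj X).X l) :
    (Φ.π Y p q l h).hom (((Φ.map g).f l).hom x) =
      ((Φ.F p).map (g.f q)).hom ((Φ.π X p q l h).hom x) :=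
  congrArg (fun f => f.hom x) (Φ.map_π g p q l h)

theorem ι_π_apply (X : Cx S) (p q l : ℤ) (h : p + q = l) (x : (Φ.F p).obj (X.X q)) :
    (Φ.π X p q l h).hom ((Φ.ι X p q l h).hom x) = x :=
  congrArg (fun f => f.hom x) (Φ.ι_π X p q l h)

theorem ι_π_of_ne_apply (X : Cx S) (p q p' q' l : ℤ) (h : p + q = l) (h' : p' + q' = l)
    (hp : p ≠ p') (x : (Φ.F p).obj (X.X q)) :
    (Φ.π X p' q' l h').hom ((Φ.ι X p q l h).hom x) = 0 :=
  congrArg (fun f => f.hom x) (Φ.ι_π_of_ne X p q p' q' l h h' hp)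

theorem ι_d_π_of_lt_apply (X : Cx S) (p q p' q' l l' : ℤ) (h : p + q = l) (h' : p' + q' = l')
    (hp : p < p') (x : (Φ.F p).obj (X.X q)) :
    (Φ.π X p' q' l' h').hom (((Φ.obj X).d l l').hom ((Φ.ι X p q l h).hom x)) = 0 :=
  congrArg (fun f => f.hom x) (Φ.ι_d_π_of_lt X p q p' q' l l' h h' hp)

theorem units_smul_units_smul {M : Type*} [AddCommGroup M] (ε : ℤˣ) (x : M) :
    ε • ε • x = x := by
  rw [smul_smul, Int.units_mul_self, one_smul]

theorem map_units_smul {M N : ModuleCat.{u} S} (f : M ⟶ N) (ε : ℤˣ) (x : M) :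
    f.hom (ε • x) = ε • f.hom x := by
  rw [Units.smul_def, Units.smul_def, map_zsmul]

/-- If a cycle `(y, x)` of the cone has no component above column `m`, its components in column `m`
form a cycle of the cone of that column, with the sign moved onto `x`. Subtracting the boundary of a
solution inserted in column `m` kills that column and creates nothing above it. -/
theorem exists_cancel_column {X Y : Cx S} (g : X ⟶ Y)
    (hg : ∀ p : ℤ, ConeExact ((Φ.column p).map g)) (m i j k : ℤ) (hij : j + 1 = i)
    (hik : i + 1 = k) (y : (Φ.obj X).X j) (x : (Φ.obj Y).X i)
    (hdy : ∀ l, ((Φ.obj X).d j l).hom y = 0)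
    (hyx : ((Φ.map g).f j).hom y = ((Φ.obj Y).d i j).hom x)
    (hy : ∀ p q (h : p + q = j), m < p → (Φ.π X p q j h).hom y = 0)
    (hx : ∀ p q (h : p + q = i), m < p → (Φ.π Y p q i h).hom x = 0) :
    ∃ (w : (Φ.obj X).X i) (z : (Φ.obj Y).X k),
      (∀ p q (h : p + q = j), m ≤ p →
        (Φ.π X p q j h).hom (y - ((Φ.obj X).d i j).hom w) = 0) ∧
      ∀ p q (h : p + q = i), m ≤ p → (Φ.π Y p q i h).hom
        (x - ((Φ.map g).f i).hom w - ((Φ.obj Y).d k i).hom z) = 0 := by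
  have e1 (r : ℤ) :
      ((Φ.F m).map (X.d (j - m) r)).hom ((Φ.π X m (j - m) j (by lia)).hom y) = 0 := by
    have := Φ.d_π_apply y m hy (j - m) r _ (by lia) rfl
    rw [hdy, map_zero] at this
    exact (smul_eq_zero_iff_eq _).1 this.symm
  have e2 : ((Φ.F m).map (g.f (j - m))).hom ((Φ.π X m (j - m) j (by lia)).hom y) =
      ((Φ.F m).map (Y.d (i - m) (j - m))).hom
        (Φ.sign m • (Φ.π Y m (i - m) i (by lia)).hom x) := by
    rw [← map_π_apply, hyx, Φ.d_π_apply x m hx (i - m) (j - m) j (by lia) (by lia),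
      map_units_smul]
  obtain ⟨w, z, hw, hz⟩ : ∃ (w : (Φ.F m).obj (X.X (i - m))) (z : (Φ.F m).obj (Y.X (k - m))),
      ((Φ.F m).map (X.d (i - m) (j - m))).hom w = (Φ.π X m (j - m) j (by lia)).hom y ∧
      Φ.sign m • (Φ.π Y m (i - m) i (by lia)).hom x = ((Φ.F m).map (g.f (i - m))).hom w +
        ((Φ.F m).map (Y.d (k - m) (i - m))).hom z :=
    hg m (i - m) (j - m) (k - m) (by lia) (by lia)
      ((Φ.π X m (j - m) j (by lia)).hom y) (Φ.sign m • (Φ.π Y m (i - m) i (by lia)).hom x) e1 e2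
  refine ⟨(Φ.ι X m (i - m) i (by lia)).hom (Φ.sign m • w), (Φ.ι Y m (k - m) k (by lia)).hom z,
    fun p q h hp => ?_, fun p q h hp => ?_⟩
  · rcases eq_or_lt_of_le hp with rfl | hp
    · obtain rfl : q = j - m := by lia
      rw [map_sub, Φ.d_π_apply (l := i) _ m (fun p q h hp => ι_π_of_ne_apply _ _ _ _ _ _ _ _ hp.ne _)
        (i - m) (j - m) j (by lia) (by lia), ι_π_apply, map_units_smul, hw, units_smul_units_smul,
        sub_self]
    · rw [map_sub, hy p q h hp, ι_d_π_of_lt_apply _ _ _ _ _ _ _ _ _ hp, sub_zero]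
  · rcases eq_or_lt_of_le hp with rfl | hp
    · obtain rfl : q = i - m := by lia
      rw [map_sub, map_sub, map_π_apply, ι_π_apply,
        Φ.d_π_apply (l := k) _ m (fun p q h hp => ι_π_of_ne_apply _ _ _ _ _ _ _ _ hp.ne _)
          (k - m) (i - m) i (by lia) (by lia), ι_π_apply, map_units_smul, sub_sub, ← smul_add,
        ← hz, units_smul_units_smul, sub_self]
    · rw [map_sub, map_sub, map_π_apply, hx p q h hp, ι_π_of_ne_apply _ _ _ _ _ _ _ _ hp.ne,
        ι_d_π_of_lt_apply _ _ _ _ _ _ _ _ _ hp, map_zero, sub_zero, sub_zero]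

/-- Induction on the number of columns that may carry the cycle, cancelling the top one each time.
-/
theorem coneExact_map {X Y : Cx S} (g : X ⟶ Y)
    (hg : ∀ p : ℤ, ConeExact ((Φ.column p).map g)) : ConeExact (Φ.map g) := by
  have key : ∀ n : ℕ, ∀ i j k : ℤ, j + 1 = i → i + 1 = k → ∀ (y : (Φ.obj X).X j)
      (x : (Φ.obj Y).X i), (∀ l, ((Φ.obj X).d j l).hom y = 0) →
      ((Φ.map g).f j).hom y = ((Φ.obj Y).d i j).hom x →
      (∀ p q (h : p + q = j), Φ.a + n ≤ p → (Φ.π X p q j h).hom y = 0) →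
      (∀ p q (h : p + q = i), Φ.a + n ≤ p → (Φ.π Y p q i h).hom x = 0) →
      ∃ (w : (Φ.obj X).X i) (z : (Φ.obj Y).X k), ((Φ.obj X).d i j).hom w = y ∧
        x = ((Φ.map g).f i).hom w + ((Φ.obj Y).d k i).hom z := by
    intro n
    induction n with
    | zero =>
      intro i j k _ _ y x _ _ hy hx
      obtain rfl : y = 0 := eq_zero_of_π fun p q h hp => hy p q h (by simp at hp; simp; lia)
      obtain rfl : x = 0 := eq_zero_of_π fun p q h hp => hx p q h (by simp at hp; simp; lia)
      exact ⟨0, 0, map_zero _, by rw [map_zero, map_zero, add_zero]⟩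
    | succ n ih =>
      intro i j k hij hik y x hdy hyx hy hx
      obtain ⟨w, z, hw, hz⟩ := exists_cancel_column g hg (Φ.a + n) i j k hij hik y x hdy hyx
        (fun p q h hp => hy p q h (by push_cast; lia))
        (fun p q h hp => hx p q h (by push_cast; lia))
      obtain ⟨w₁, z₁, h₁, h₂⟩ := ih i j k hij hik _ _
        (fun l => by rw [map_sub, hdy, d_d_apply, sub_zero])
        (by rw [map_sub, map_sub, map_sub, d_d_apply, hom_d_apply, hyx, sub_zero]) hw hz
      refine ⟨w₁ + w, z₁ + z, by rw [map_add, h₁, sub_add_cancel], ?_⟩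
      rw [sub_sub, sub_eq_iff_eq_add] at h₂
      rw [h₂, map_add, map_add]
      abel
  intro i j k hij hik y x hdy hyx
  refine key (Φ.b + 1 - Φ.a).toNat i j k hij hik y x hdy hyx (fun p q h hp => ?_)
    (fun p q h hp => ?_)
  · rw [Φ.π_eq_zero _ _ _ _ _ (by rw [Finset.mem_Icc]; lia)]
    rfl
  · rw [Φ.π_eq_zero _ _ _ _ _ (by rw [Finset.mem_Icc]; lia)]
    rfl

theorem projective_X {X : Cx S} (h : ∀ p q, Projective ((Φ.F p).obj (X.X q))) (l : ℤ) :
    Projective ((Φ.obj X).X l) where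
  factors {E N} f e _ := by
    refine ⟨∑ p ∈ Finset.Icc Φ.a Φ.b, Φ.π X p (l - p) l (by lia) ≫
      Projective.factorThru (Φ.ι X p (l - p) l (by lia) ≫ f) e, ?_⟩
    conv_rhs => rw [← Category.id_comp f, ← Φ.sum_π_ι, Preadditive.sum_comp]
    rw [Preadditive.sum_comp]
    refine Finset.sum_congr rfl fun p _ => ?_
    rw [Category.assoc, Projective.factorThru_comp, Category.assoc]

/-- `Φ.map g` is diagonal, and `l - p ≥ n` for every column `p ≤ b`. This is the source of the
summand `b` in the final bounds. -/
theorem isIso_map_f {X Y : Cx S} (g : X ⟶ Y) (n : ℤ) (hg : ∀ i ≥ n, IsIso (g.f i)) (l : ℤ)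
    (hl : n + Φ.b ≤ l) : IsIso ((Φ.map g).f l) := by
  have (p : ℤ) : ∃ k : (Φ.F p).obj (Y.X (l - p)) ⟶ (Φ.F p).obj (X.X (l - p)),
      p ∈ Finset.Icc Φ.a Φ.b → (Φ.F p).map (g.f (l - p)) ≫ k = 𝟙 _ ∧
        k ≫ (Φ.F p).map (g.f (l - p)) = 𝟙 _ := by
    by_cases hp : p ∈ Finset.Icc Φ.a Φ.b
    · have := hg (l - p) (by rw [Finset.mem_Icc] at hp; lia)
      exact ⟨inv ((Φ.F p).map (g.f (l - p))), fun _ => ⟨IsIso.hom_inv_id _, IsIso.inv_hom_id _⟩⟩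
    · exact ⟨0, fun h => (hp h).elim⟩
  choose k hk using this
  refine ⟨∑ p ∈ Finset.Icc Φ.a Φ.b, Φ.π Y p (l - p) l (by lia) ≫ k p ≫
    Φ.ι X p (l - p) l (by lia), ?_, ?_⟩
  · rw [← Φ.sum_π_ι, Preadditive.comp_sum]
    refine Finset.sum_congr rfl fun p hp => ?_
    rw [← Category.assoc, Φ.map_π, Category.assoc, ← Category.assoc ((Φ.F p).map _),
      (hk p hp).1, Category.id_comp]
  · rw [← Φ.sum_π_ι, Preadditive.sum_comp]
    refine Finset.sum_congr rfl fun p hp => ?_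
    rw [Category.assoc, Category.assoc, Φ.ι_map, ← Category.assoc (k p),
      (hk p hp).2, Category.id_comp]

end TriangularFunctor

end Triangular

/-! ### Natural summands of powers `M ↦ M^(I)`. -/

section Power

variable {S : Type u} [Ring S]

/-- The functor `M ↦ M^(I)`. -/
def powerFunctor (S : Type u) [Ring S] (I : Type u) : ModuleCat.{u} S ⥤ ModuleCat.{u} S where
  obj M := ModuleCat.of S (I →₀ M)
  map f := ModuleCat.ofHom (Finsupp.mapRange.linearMap f.hom)
  map_id M := by ext : 1; exact Finsupp.mapRange.linearMap_id
  map_comp f g := by ext : 1; exact Finsupp.mapRange.linearMap_comp g.hom f.hom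

/-- The inclusion of a summand `M ⟶ M^(I)`. -/
def powerι {I : Type u} (i : I) (M : ModuleCat.{u} S) : M ⟶ (powerFunctor S I).obj M :=
  ModuleCat.ofHom (Finsupp.lsingle i)

/-- The morphism `M^(I) ⟶ N` with given components. -/
def powerDesc {I : Type u} {M N : ModuleCat.{u} S} (k : I → (M ⟶ N)) :
    (powerFunctor S I).obj M ⟶ N :=
  ModuleCat.ofHom (Finsupp.lsum ℕ (fun i => (k i).hom))

theorem powerι_naturality {I : Type u} (i : I) {M N : ModuleCat.{u} S} (g : M ⟶ N) :
    g ≫ powerι i N = powerι i M ≫ (powerFunctor S I).map g := by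
  ext1
  exact LinearMap.ext fun x => (Finsupp.mapRange_single (hf := map_zero g.hom)).symm

theorem powerι_desc {I : Type u} {M N : ModuleCat.{u} S} (k : I → (M ⟶ N)) (i : I) :
    powerι i M ≫ powerDesc k = k i := by
  ext x
  exact Finsupp.lsum_single ℕ _ i x

theorem power_ext {I : Type u} {M N : ModuleCat.{u} S} {p q : (powerFunctor S I).obj M ⟶ N}
    (h : ∀ i, powerι i M ≫ p = powerι i M ≫ q) : p = q := by
  ext1
  exact Finsupp.lhom_ext' fun i => congrArg ModuleCat.Hom.hom (h i)

/-- `F` is a natural direct summand of a functor `M ↦ M^(I)`. -/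
def IsRetractOfPower (F : ModuleCat.{u} S ⥤ ModuleCat.{u} S) : Prop :=
  ∃ (I : Type u) (j : F ⟶ powerFunctor S I) (r : powerFunctor S I ⟶ F), j ≫ r = 𝟙 F

namespace IsRetractOfPower

variable {F : ModuleCat.{u} S ⥤ ModuleCat.{u} S} (hF : IsRetractOfPower F)
include hF

theorem projective (M : ModuleCat.{u} S) (hM : Module.Projective S M) :
    Projective (F.obj M) := by
  obtain ⟨I, j, r, hjr⟩ := hF
  have hM' : Projective M := (IsProjective.iff_projective M).1 hM
  have : Projective ((powerFunctor S I).obj M) := ⟨fun f e _ =>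
    ⟨powerDesc fun i => Projective.factorThru (powerι i M ≫ f) e, power_ext fun i => by
      rw [← Category.assoc, powerι_desc, Projective.factorThru_comp]⟩⟩
  exact (Retract.mk (j.app M) (r.app M) (NatTrans.congr_app hjr M)).projective

/-- Embed the cycle in the power by `j`, solve in each coordinate, and bring the solution back by
`r`; naturality makes both maps commute with the differentials. -/
theorem coneExact [F.Additive] {K L : Cx S} {g : K ⟶ L} (hg : ConeExact g) :
    ConeExact ((F.mapHomologicalComplex _).map g) := by
  classical
  obtain ⟨I, j, r, hjr⟩ := hF
  have jr {M : ModuleCat.{u} S} (x : F.obj M) : (r.app M).hom ((j.app M).hom x) = x :=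
    congrArg (fun f => (f.app M).hom x) hjr
  have jn {M N : ModuleCat.{u} S} (f : M ⟶ N) (x : F.obj M) (i : I) :
      f.hom ((show I →₀ M from (j.app M).hom x) i) =
        (show I →₀ N from (j.app N).hom ((F.map f).hom x)) i :=
    (congrArg (fun u => (show I →₀ N from u.hom x) i) (j.naturality f)).symm
  have rn {M N : ModuleCat.{u} S} (f : M ⟶ N) (x : I →₀ M) :
      (F.map f).hom ((r.app M).hom x) = (r.app N).hom (Finsupp.mapRange.linearMap f.hom x) :=
    (congrArg (fun u => u.hom x) (r.naturality f)).symm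
  intro a b c hab hac (y : F.obj (K.X b)) (x : F.obj (L.X a)) hy hx
  change ∀ l, (F.map (K.d b l)).hom y = 0 at hy
  change (F.map (g.f b)).hom y = (F.map (L.d a b)).hom x at hx
  set Y : I →₀ K.X b := (j.app _).hom y with hY
  set X : I →₀ L.X a := (j.app _).hom x with hX
  have H (i : I) := hg a b c hab hac (Y i) (X i)
    (fun l => by rw [jn, hy, map_zero]; rfl) (by rw [jn, jn, hx])
  choose w z hw hz using H
  -- The chosen `w i` and `z i` need not vanish where the data do, so they are cut off outside the
  -- joint support to stay in the direct sum.
  let s := Y.support ∪ X.support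
  let W : I →₀ K.X a := Finsupp.onFinset s (fun i => if i ∈ s then w i else 0)
    (fun i hi => by by_contra h; exact hi (if_neg h))
  let Z : I →₀ L.X c := Finsupp.onFinset s (fun i => if i ∈ s then z i else 0)
    (fun i hi => by by_contra h; exact hi (if_neg h))
  have hs (i : I) (hi : i ∉ s) : Y i = 0 ∧ X i = 0 := by
    simpa [s] using hi
  refine ⟨(r.app _).hom W, (r.app _).hom Z, ?_, ?_⟩
  · refine (rn (K.d a b) W).trans (Eq.trans (congrArg (r.app _).hom ?_) (jr y))
    refine Finsupp.ext fun i => ?_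
    change (K.d a b).hom (if i ∈ s then w i else 0) = Y i
    split_ifs with hi
    · exact hw i
    · rw [map_zero, (hs i hi).1]
  · refine Eq.trans (Eq.trans (jr x).symm ?_)
      (congrArg₂ (· + ·) (rn (g.f a) W) (rn (L.d c a) Z)).symm
    refine Eq.trans (congrArg (r.app _).hom ?_) (map_add (r.app _).hom _ _)
    refine Finsupp.ext fun i => ?_
    change X i = (g.f a).hom (if i ∈ s then w i else 0) + (L.d c a).hom (if i ∈ s then z i else 0)
    split_ifs with hi
    · exact hz i
    · rw [map_zero, map_zero, (hs i hi).2, add_zero]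

/-- A map out of `K^(I)` is a family of maps out of `K`, and null-homotopies of the members assemble
without any finiteness condition on `I`. The target `E` does not change. -/
theorem orth [F.Additive] {K E : Cx S} (h : Orth K E) :
    Orth ((F.mapHomologicalComplex _).obj K) E := by
  obtain ⟨I, j, r, hjr⟩ := hF
  intro f
  obtain ⟨f', hf', hfd⟩ : ∃ f' : ∀ q, F.obj (K.X q) ⟶ E.X q, (∀ q, f' q = f.f q) ∧
      ∀ a b, f' a ≫ E.d a b = F.map (K.d a b) ≫ f' b := ⟨f.f, fun _ => rfl, f.comm⟩
  let v (i : I) : K ⟶ E :=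
    { f := fun q => powerι i _ ≫ r.app _ ≫ f' q
      comm' := fun a b _ => by
        rw [Category.assoc, Category.assoc, hfd, ← Category.assoc (r.app _), ← r.naturality,
          ← Category.assoc (K.d a b), powerι_naturality, Category.assoc, Category.assoc] }
  have H (i : I) := (nonempty_homotopy_zero_iff _).1 (h (v i))
  choose k hk using H
  refine (nonempty_homotopy_zero_iff f).2
    ⟨fun a b => j.app _ ≫ powerDesc (fun i => k i a b), fun a b c hb hc => ?_⟩
  have key : r.app (K.X a) ≫ f' a = (powerFunctor S I).map (K.d a b) ≫
      powerDesc (fun i => k i b a) + powerDesc (fun i => k i a c) ≫ E.d c a := by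
    refine power_ext fun i => ?_
    rw [Preadditive.comp_add, ← Category.assoc _ (powerDesc _), powerι_desc, ← Category.assoc,
      ← Category.assoc _ ((powerFunctor S I).map _), ← powerι_naturality, Category.assoc,
      Category.assoc, powerι_desc, ← hk i a b c hb hc]
  have hj : j.app (K.X a) ≫ r.app (K.X a) = 𝟙 _ := NatTrans.congr_app hjr _
  have e : f' a = F.map (K.d a b) ≫ j.app _ ≫ powerDesc (fun i => k i b a) +
      (j.app _ ≫ powerDesc (fun i => k i a c)) ≫ E.d c a := by
    rw [← Category.id_comp (f' a), ← hj, Category.assoc, key, Preadditive.comp_add,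
      ← Category.assoc, ← j.naturality, Category.assoc, Category.assoc]
  rw [← hf', e]
  rfl

end IsRetractOfPower

end Power

/-! ### Preservation of `𝓕`-complete resolutions. -/

section FComplete

variable {S : Type u} [Ring S]

/-- `E` is a flat module placed in a single degree. -/
def IsFlatConcentrated (E : Cx S) : Prop :=
  ∃ n : ℤ, IsFlat S (E.X n) ∧ ∀ i ≠ n, IsZero (E.X i)

theorem IsFlatConcentrated.signShift {E : Cx S} (hE : IsFlatConcentrated E) (m : ℤ) (ε : ℤˣ) :
    IsFlatConcentrated (signShift m ε E) := by
  obtain ⟨n, hn, h0⟩ := hE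
  refine ⟨n - m, ?_, fun i hi => h0 _ (by lia)⟩
  have : m + (n - m) = n := by lia
  change IsFlat S (E.X (m + (n - m)))
  rwa [this]

/-- With `hom_exact_of_orth`, this recasts exactness of `Hom(T, F)` as a null-homotopy condition,
the form that passes through `orth_of_column`. The homotopy has a single nonzero entry, the
factorization `g` from degree `n - 1` to degree `n`. -/
theorem IsTotallyFlatAcyclic.orth {T : Cx S} (hT : IsTotallyFlatAcyclic T) {E : Cx S}
    (hE : IsFlatConcentrated E) : Orth T E := by
  obtain ⟨n, hn, h0⟩ := hE
  intro f
  obtain ⟨g, hg⟩ := hT.hom_exact (E.X n) hn n (f.f n)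
    (by rw [← f.comm, (h0 (n + 1) (by lia)).eq_zero_of_src (E.d _ _), comp_zero])
  refine (nonempty_homotopy_zero_iff f).2
    ⟨fun a b => if h : a = n - 1 ∧ b = n then
      (T.XIsoOfEq h.1).hom ≫ g ≫ (E.XIsoOfEq h.2.symm).hom else 0, fun a b c hb hc => ?_⟩
  by_cases ha : a = n
  · subst ha
    obtain rfl : b = a - 1 := by lia
    beta_reduce
    rw [dif_pos ⟨rfl, rfl⟩, dif_neg (by lia)]
    simp [hg]
  · exact (h0 a ha).eq_of_tgt _ _

theorem hom_exact_of_orth {T : Cx S} (hT : ∀ E : Cx S, IsFlatConcentrated E → Orth T E)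
    (F : ModuleCat.{u} S) (hF : IsFlat S F) (n : ℤ) (f : T.X n ⟶ F)
    (hf : T.d (n + 1) n ≫ f = 0) : ∃ g : T.X (n - 1) ⟶ F, T.d n (n - 1) ≫ g = f := by
  classical
  let E : Cx S := (HomologicalComplex.single _ _ n).obj F
  have hE : IsFlatConcentrated E := by
    refine ⟨n, ?_, fun i hi => HomologicalComplex.isZero_single_obj_X _ _ _ _ hi⟩
    have : F = E.X n := (HomologicalComplex.single_obj_X_self (ComplexShape.down ℤ) n F).symm
    exact this ▸ hF
  obtain ⟨h, hh⟩ := (nonempty_homotopy_zero_iff _).1 (hT E hE (HomologicalComplex.mkHomToSingle f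
    (fun i hi => by obtain rfl : n + 1 = i := hi; exact hf)))
  refine ⟨h (n - 1) n ≫ (HomologicalComplex.singleObjXSelf _ n F).hom, ?_⟩
  have := hh n (n - 1) (n + 1) (by lia) rfl
  rw [HomologicalComplex.mkHomToSingle_f, show E.d (n + 1) n = 0 from rfl, comp_zero, add_zero] at this
  rw [← Category.assoc, ← this, Category.assoc, Iso.inv_hom_id, Category.comp_id]

namespace TriangularFunctor

variable (Φ : TriangularFunctor S)

theorem bijective_map_f {X Y : Cx S} (g : X ⟶ Y) (n : ℤ)
    (hg : ∀ i ≥ n, Function.Bijective (g.f i)) (l : ℤ) (hl : l ≥ n + Φ.b) :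
    Function.Bijective ((Φ.map g).f l) := by
  have := Φ.isIso_map_f g n (fun i hi => (ConcreteCategory.isIso_iff_bijective _).2 (hg i hi)) l hl
  exact (ConcreteCategory.isIso_iff_bijective _).1 this

variable (hΦ : ∀ p, IsRetractOfPower (Φ.F p))
include hΦ

theorem projective_obj_X {X : Cx S} (hX : ∀ n, Module.Projective S (X.X n)) (n : ℤ) :
    Module.Projective S ((Φ.obj X).X n) :=
  (IsProjective.iff_projective _).2
    (Φ.projective_X (fun p q => (hΦ p).projective _ (hX q)) n)

theorem quasiIso_map {X Y : Cx S} (g : X ⟶ Y) (hg : QuasiIso g) : QuasiIso (Φ.map g) := by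
  rw [quasiIso_iff_coneExact] at hg ⊢
  exact Φ.coneExact_map g fun p => (hΦ p).coneExact hg

theorem acyclic_obj {X : Cx S} (hX : X.Acyclic) : (Φ.obj X).Acyclic := by
  rw [acyclic_iff_coneExact_zero] at hX ⊢
  have := Φ.coneExact_map 0 fun p => (hΦ p).coneExact hX
  rwa [Φ.map_zero'] at this

theorem isDGProjective_obj {P : Cx S} (hP : IsDGProjective P) : IsDGProjective (Φ.obj P) where
  projective := Φ.projective_obj_X hΦ hP.projective
  homotopy_zero := Φ.orth_of_column (fun E => E.Acyclic)
    (fun m ε _ hE => acyclic_signShift hE m ε) P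
    (fun p E hE => (hΦ p).orth (hP.homotopy_zero E hE))

theorem isTotallyFlatAcyclic_obj {T : Cx S} (hT : IsTotallyFlatAcyclic T) :
    IsTotallyFlatAcyclic (Φ.obj T) where
  projective := Φ.projective_obj_X hΦ hT.projective
  exact := Φ.acyclic_obj hΦ hT.exact
  hom_exact := hom_exact_of_orth (Φ.orth_of_column IsFlatConcentrated
    (fun m ε _ hE => hE.signShift m ε) T (fun p _ hE => (hΦ p).orth (hT.orth hE)))

/-- Triangular functors built from direct summands of powers preserve `𝓕`-complete resolutions. -/
def mapResolution {X : Cx S} (C : FCompleteResolution X) : FCompleteResolution (Φ.obj X) where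
  T := Φ.obj C.T
  P := Φ.obj C.P
  τ := Φ.map C.τ
  π := Φ.map C.π
  resolution := ⟨Φ.isDGProjective_obj hΦ C.resolution.dgProjective,
    Φ.quasiIso_map hΦ _ C.resolution.quasiIso⟩
  totallyAcyclic := Φ.isTotallyFlatAcyclic_obj hΦ C.totallyAcyclic
  bijective := by
    obtain ⟨m, hm⟩ := C.bijective
    exact ⟨m + Φ.b, Φ.bijective_map_f C.τ m hm⟩

theorem dpd_le {X Y : Cx S} (h : QuasiIsomorphic (Φ.obj X) Y) (C : FCompleteResolution X) (n : ℤ)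
    (hn : ∀ i ≥ n, Function.Bijective (C.τ.f i)) : dpd Y ≤ (((n + Φ.b : ℤ) : ℝ) : EReal) :=
  dpd_le_of_quasiIsomorphic h (Φ.mapResolution hΦ C) _ (Φ.bijective_map_f C.τ n hn)

end TriangularFunctor

end FComplete

/-! ### The functor `P ⊗_R -` for a bounded complex `P`. -/

section Tensor

variable {R S : Type u} [Ring R] [Ring S] (φ : R →+* S) (hφ : ∀ r s, φ r * s = s * φ r)

/-- The inclusion of a summand of `P ⊗_R X`. -/
def tensorι (P : Cx Rᵐᵒᵖ) (X : Cx S) (p q l : ℤ) (h : p + q = l) :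
    ((tensorBifunctor φ hφ).obj (P.X p)).obj (X.X q) ⟶ (tensorComplex φ hφ P X).X l :=
  HomologicalComplex.ιMapBifunctor P X (tensorBifunctor φ hφ) (ComplexShape.down ℤ) p q l h

theorem tensor_hom_ext {P : Cx Rᵐᵒᵖ} {X : Cx S} {l : ℤ} {M : ModuleCat.{u} S}
    {f g : (tensorComplex φ hφ P X).X l ⟶ M}
    (h : ∀ p q (hpq : p + q = l),
      tensorι φ hφ P X p q l hpq ≫ f = tensorι φ hφ P X p q l hpq ≫ g) : f = g :=
  HomologicalComplex.mapBifunctor.hom_ext h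

/-- The morphism from a term of `P ⊗_R X` with given components. -/
def tensorDesc {P : Cx Rᵐᵒᵖ} {X : Cx S} {l : ℤ} {M : ModuleCat.{u} S}
    (f : ∀ p q : ℤ, p + q = l → (((tensorBifunctor φ hφ).obj (P.X p)).obj (X.X q) ⟶ M)) :
    (tensorComplex φ hφ P X).X l ⟶ M :=
  HomologicalComplex.mapBifunctorDesc f

theorem tensorι_desc {P : Cx Rᵐᵒᵖ} {X : Cx S} {l : ℤ} {M : ModuleCat.{u} S}
    (f : ∀ p q : ℤ, p + q = l → (((tensorBifunctor φ hφ).obj (P.X p)).obj (X.X q) ⟶ M))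
    (p q : ℤ) (h : p + q = l) : tensorι φ hφ P X p q l h ≫ tensorDesc φ hφ f = f p q h :=
  HomologicalComplex.ι_mapBifunctorDesc (K₁ := P) (K₂ := X) (F := tensorBifunctor φ hφ)
    (c := ComplexShape.down ℤ) f p q h

theorem tensorι_d (P : Cx Rᵐᵒᵖ) (X : Cx S) (p p' q q' l l' : ℤ) (h : p + q = l)
    (hp : p' + 1 = p) (hq : q' + 1 = q) (h' : p' + q = l') (h'' : p + q' = l') :
    tensorι φ hφ P X p q l h ≫ (tensorComplex φ hφ P X).d l l' =
      ((tensorBifunctor φ hφ).map (P.d p p')).app (X.X q) ≫ tensorι φ hφ P X p' q l' h' +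
      (ComplexShape.down ℤ).ε p • ((tensorBifunctor φ hφ).obj (P.X p)).map (X.d q q') ≫
        tensorι φ hφ P X p q' l' h'' := by
  have e1 := HomologicalComplex.mapBifunctor.d₁_eq P X (tensorBifunctor φ hφ) (ComplexShape.down ℤ)
    (show (ComplexShape.down ℤ).Rel p p' from hp) q l' h'
  have e2 := HomologicalComplex.mapBifunctor.d₂_eq P X (tensorBifunctor φ hφ) (ComplexShape.down ℤ)
    p (show (ComplexShape.down ℤ).Rel q q' from hq) l' h''
  have e3 := HomologicalComplex.mapBifunctor.ι_D₁ P X (tensorBifunctor φ hφ) (ComplexShape.down ℤ)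
    l l' p q h
  have e4 := HomologicalComplex.mapBifunctor.ι_D₂ P X (tensorBifunctor φ hφ) (ComplexShape.down ℤ)
    l l' p q h
  refine Eq.trans (Preadditive.comp_add _ _ _ _ _ _) ?_
  refine congrArg₂ (· + ·) (e3.trans (e1.trans ?_)) (e4.trans e2)
  exact one_smul ℤˣ _

/-- The projection to a summand of `P ⊗_R X`. -/
def tensorπ (P : Cx Rᵐᵒᵖ) (X : Cx S) (p q l : ℤ) (h : p + q = l) :
    (tensorComplex φ hφ P X).X l ⟶ ((tensorBifunctor φ hφ).obj (P.X p)).obj (X.X q) :=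
  tensorDesc φ hφ fun p' q' h' =>
    if hp : p' = p then ((tensorBifunctor φ hφ).map (P.XIsoOfEq hp).hom).app _ ≫
      ((tensorBifunctor φ hφ).obj (P.X p)).map (X.XIsoOfEq (show q' = q by lia)).hom else 0

theorem tensorι_π (P : Cx Rᵐᵒᵖ) (X : Cx S) (p q l : ℤ) (h : p + q = l) :
    tensorι φ hφ P X p q l h ≫ tensorπ φ hφ P X p q l h = 𝟙 _ := by
  rw [tensorπ, tensorι_desc, dif_pos rfl]
  simp

theorem tensorι_π_of_ne (P : Cx Rᵐᵒᵖ) (X : Cx S) (p q p' q' l : ℤ) (h : p + q = l)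
    (h' : p' + q' = l) (hp : p ≠ p') :
    tensorι φ hφ P X p q l h ≫ tensorπ φ hφ P X p' q' l h' = 0 := by
  rw [tensorπ, tensorι_desc, dif_neg hp]

theorem isZero_tensorBifunctor_obj (A : ModuleCat.{u} Rᵐᵒᵖ) (hA : Subsingleton A)
    (M : ModuleCat.{u} S) : IsZero (((tensorBifunctor φ hφ).obj A).obj M) := by
  have h1 : 𝟙 A = 0 := (ModuleCat.isZero_of_subsingleton A).eq_of_src _ _
  have h2 := congrArg (fun f => ((tensorBifunctor φ hφ).map f).app M) h1
  rw [IsZero.iff_id_eq_zero]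
  simpa using h2

theorem tensor_sum_π_ι (P : Cx Rᵐᵒᵖ) (X : Cx S) (a b : ℤ)
    (hP : ∀ i, (i < a ∨ b < i) → Subsingleton (P.X i)) (l : ℤ) :
    ∑ p ∈ Finset.Icc a b, tensorπ φ hφ P X p (l - p) l (by lia) ≫
      tensorι φ hφ P X p (l - p) l (by lia) = 𝟙 _ := by
  refine tensor_hom_ext φ hφ fun p q h => ?_
  rw [Preadditive.comp_sum]
  by_cases hp : p ∈ Finset.Icc a b
  · rw [Finset.sum_eq_single_of_mem p hp]
    · obtain rfl : q = l - p := by lia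
      rw [← Category.assoc, tensorι_π, Category.id_comp, Category.comp_id]
    · intro p' _ hp'
      rw [← Category.assoc, tensorι_π_of_ne _ _ _ _ _ _ _ _ _ _ _ hp'.symm, zero_comp]
  · exact (isZero_tensorBifunctor_obj φ hφ _
      (hP p (by rw [Finset.mem_Icc] at hp; lia)) _).eq_of_src _ _

/-- The functor `P ⊗_R -` for a bounded complex `P`. -/
def tensorTriangular (P : Cx Rᵐᵒᵖ) (a b : ℤ)
    (hP : ∀ i, (i < a ∨ b < i) → Subsingleton (P.X i)) : TriangularFunctor S where
  obj X := tensorComplex φ hφ P X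
  map g := HomologicalComplex.mapBifunctorMap (𝟙 P) g (tensorBifunctor φ hφ) _
  F p := (tensorBifunctor φ hφ).obj (P.X p)
  additive p := inferInstance
  sign p := (ComplexShape.down ℤ).ε p
  a := a
  b := b
  ι X := tensorι φ hφ P X
  π X := tensorπ φ hφ P X
  ι_π X := tensorι_π φ hφ P X
  ι_π_of_ne X := tensorι_π_of_ne φ hφ P X
  sum_π_ι X := tensor_sum_π_ι φ hφ P X a b hP
  ι_map {X Y} g p q l h := by
    refine (HomologicalComplex.ι_mapBifunctorMap (𝟙 P) g (tensorBifunctor φ hφ) _ p q l h).trans ?_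
    rw [HomologicalComplex.id_f, CategoryTheory.Functor.map_id, NatTrans.id_app]
    exact Category.id_comp _
  ι_d_π X p q q' l l' h h' := by
    by_cases hl : l' + 1 = l
    · rw [← Category.assoc, tensorι_d φ hφ P X p (p - 1) q q' l l' h (by lia) (by lia) (by lia) h',
        Preadditive.add_comp, Category.assoc, tensorι_π_of_ne _ _ _ _ _ _ _ _ _ _ _ (by lia),
        comp_zero, zero_add, Linear.units_smul_comp, Category.assoc, tensorι_π, Category.comp_id]
    · rw [HomologicalComplex.shape _ _ _ hl, zero_comp, comp_zero, X.shape _ _ (by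
        change q' + 1 ≠ q; lia), Functor.map_zero, smul_zero]
  ι_d_π_of_lt X p q p' q' l l' h h' hp := by
    by_cases hl : l' + 1 = l
    · rw [← Category.assoc, tensorι_d φ hφ P X p (p - 1) q (q - 1) l l' h (by lia) (by lia)
        (by lia) (by lia), Preadditive.add_comp, Category.assoc,
        tensorι_π_of_ne _ _ _ _ _ _ _ _ _ _ _ (by lia),
        comp_zero, zero_add, Linear.units_smul_comp, Category.assoc,
        tensorι_π_of_ne _ _ _ _ _ _ _ _ _ _ _ (by lia), comp_zero, smul_zero]
    · rw [HomologicalComplex.shape _ _ _ hl, zero_comp, comp_zero]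

/-- `P ⊗_R X` depends on `P` only up to homotopy equivalence. -/
theorem quasiIsomorphic_tensorComplex {P Q : Cx Rᵐᵒᵖ} (e : HomotopyEquiv P Q) (X : Cx S) :
    QuasiIsomorphic (tensorComplex φ hφ P X) (tensorComplex φ hφ Q X) := by
  let Φ : Cx Rᵐᵒᵖ ⥤ Cx S :=
    ((tensorBifunctor φ hφ).map₂HomologicalComplex (ComplexShape.down ℤ) (ComplexShape.down ℤ)
      (ComplexShape.down ℤ)).flip.obj X
  have h {A B : Cx Rᵐᵒᵖ} {f g : A ⟶ B} (h : Homotopy f g) : Homotopy (Φ.map f) (Φ.map g) :=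
    HomologicalComplex.mapBifunctorMapHomotopy₁ h (𝟙 X) (tensorBifunctor φ hφ) _
  refine .of_homotopyEquiv (X := Φ.obj P) (Y := Φ.obj Q) ⟨Φ.map e.hom, Φ.map e.inv, ?_, ?_⟩
  · exact (Homotopy.ofEq (Φ.map_comp _ _).symm).trans
      ((h e.homotopyHomInvId).trans (Homotopy.ofEq (Φ.map_id _)))
  · exact (Homotopy.ofEq (Φ.map_comp _ _).symm).trans
      ((h e.homotopyInvHomId).trans (Homotopy.ofEq (Φ.map_id _)))

section Retract

variable {A : Type u} [AddCommGroup A] [Module Rᵐᵒᵖ A] (σ : A →ₗ[Rᵐᵒᵖ] A →₀ Rᵐᵒᵖ)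

/-- The map `r ↦ φ(r) m`. -/
def scalarMap (M : ModuleCat.{u} S) (m : M) : Rᵐᵒᵖ →+ M :=
  ((LinearMap.toSpanSingleton S M m).toAddMonoidHom.comp φ.toAddMonoidHom).comp
    MulOpposite.opAddEquiv.symm.toAddMonoidHom

/-- The map `A ⊗_R M → M^(A)` induced by a map `σ` from `A` to a free module. -/
def tensorToPower (M : ModuleCat.{u} S) :
    haveI := res_smulCommClass φ hφ M
    BalTensor S R A (res φ M) →ₗ[S] (A →₀ M) :=
  haveI := res_smulCommClass φ hφ M
  Submodule.liftQ _ (AlgebraTensorModule.lift (M := res φ M)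
    { toFun := fun m =>
        ((Finsupp.mapRange.addMonoidHom (scalarMap φ M m)).comp σ.toAddMonoidHom).toIntLinearMap
      map_add' := fun m m' => by
        ext a i
        exact smul_add (φ (σ a i).unop) (show M from m) (show M from m')
      map_smul' := fun s m => by
        ext a i
        change φ (σ a i).unop • s • (show M from m) = s • φ (σ a i).unop • (show M from m)
        -- Centrality enters here: multiplication by `φ r` has to be `S`-linear.
        rw [smul_smul, smul_smul, hφ] }) (by
    refine Submodule.span_le.2 ?_
    rintro _ ⟨r, m, a, rfl⟩
    simp only [SetLike.mem_coe, LinearMap.mem_ker, map_sub, sub_eq_zero]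
    refine Finsupp.ext fun i => ?_
    change φ (σ a i).unop • φ r • (show M from m) =
      φ (σ (MulOpposite.op r • a) i).unop • (show M from m)
    rw [map_smul, Finsupp.smul_apply, smul_smul, ← map_mul]
    rfl)

/-- The map `M^(A) → A ⊗_R M` whose component at `a` is `m ↦ a ⊗ m`. -/
def powerToTensor (A : Type u) [AddCommGroup A] [Module Rᵐᵒᵖ A] (M : ModuleCat.{u} S) :
    haveI := res_smulCommClass φ hφ M
    (A →₀ M) →ₗ[S] BalTensor S R A (res φ M) :=
  haveI := res_smulCommClass φ hφ M
  Finsupp.lsum ℕ fun a =>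
    { toFun := fun m => Submodule.Quotient.mk ((show res φ M from m) ⊗ₜ[ℤ] a)
      map_add' := fun _ _ => congrArg Submodule.Quotient.mk (TensorProduct.add_tmul _ _ _)
      map_smul' := fun _ _ => rfl }

theorem powerToTensor_single (A : Type u) [AddCommGroup A] [Module Rᵐᵒᵖ A] (M : ModuleCat.{u} S)
    (a : A) (m : M) :
    haveI := res_smulCommClass φ hφ M
    powerToTensor φ hφ A M (Finsupp.single a m) =
      (Submodule.Quotient.mk ((show res φ M from m) ⊗ₜ[ℤ] a) : BalTensor S R A (res φ M)) :=
  Finsupp.lsum_single ℕ _ a m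

theorem tensorToPower_mk (M : ModuleCat.{u} S) (m : M) (a : A) :
    haveI := res_smulCommClass φ hφ M
    tensorToPower φ hφ σ M
      (Submodule.Quotient.mk ((show res φ M from m) ⊗ₜ[ℤ] a) : BalTensor S R A (res φ M)) =
        (σ a).mapRange (scalarMap φ M m) (map_zero _) := rfl

/-- The balancing relation moves each coefficient of `σ a` from `m` back to the basis element; the
sum then reassembles to `a` because `σ` is a section. -/
theorem powerToTensor_tensorToPower (hσ : Function.LeftInverse (Finsupp.linearCombination Rᵐᵒᵖ id) σ)
    (M : ModuleCat.{u} S) (m : M) (a : A) :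
    haveI := res_smulCommClass φ hφ M
    powerToTensor φ hφ A M (tensorToPower φ hφ σ M
      (Submodule.Quotient.mk ((show res φ M from m) ⊗ₜ[ℤ] a) : BalTensor S R A (res φ M))) =
        Submodule.Quotient.mk ((show res φ M from m) ⊗ₜ[ℤ] a) := by
  have := res_smulCommClass φ hφ M
  let mk : A →+ BalTensor S R A (res φ M) :=
    (Submodule.mkQ (balancedRel S R A (res φ M))).toAddMonoidHom.comp
      (TensorProduct.mk ℤ (res φ M) A (show res φ M from m)).toAddMonoidHom
  have h (r : Rᵐᵒᵖ) (i : A) : powerToTensor φ hφ A M (Finsupp.single i (scalarMap φ M m r)) =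
      mk (r • i) := by
    rw [powerToTensor_single]
    exact (Submodule.Quotient.eq _).2 (Submodule.subset_span ⟨r.unop, m, i, rfl⟩)
  have key (x : A →₀ Rᵐᵒᵖ) : powerToTensor φ hφ A M (x.mapRange (scalarMap φ M m) (map_zero _)) =
      mk (Finsupp.linearCombination Rᵐᵒᵖ id x) := by
    induction x using Finsupp.induction_linear with
    | zero => simp
    | add x y hx hy =>
      rw [Finsupp.mapRange_add (map_add _), map_add, hx, hy, map_add, map_add]
    | single i r =>
      rw [Finsupp.mapRange_single, h, Finsupp.linearCombination_single]
      rfl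
  rw [tensorToPower_mk, key, hσ a]
  rfl

end Retract

/-- Projectivity splits the canonical surjection from the free module on the elements of `A`.
Tensoring turns this free module into a power, for any index set. -/
theorem isRetractOfPower_tensor (A : ModuleCat.{u} Rᵐᵒᵖ) (hA : Module.Projective Rᵐᵒᵖ A) :
    IsRetractOfPower ((tensorBifunctor φ hφ).obj A) := by
  obtain ⟨σ, hσ⟩ := hA.out
  refine ⟨A,
    { app := fun M => ModuleCat.ofHom (tensorToPower φ hφ σ M)
      naturality := fun M N g => ?_ },
    { app := fun M => ModuleCat.ofHom (powerToTensor φ hφ A M)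
      naturality := fun M N g => ?_ }, ?_⟩
  · have := res_smulCommClass φ hφ M
    ext1
    refine BalTensor.hom_ext S R fun m a => Finsupp.ext fun i => ?_
    exact (g.hom.map_smul _ _).symm
  · refine power_ext fun a => ?_
    ext m
    refine Eq.trans ?_ (congrArg (((tensorBifunctor φ hφ).obj A).map g).hom
      (powerToTensor_single φ hφ A M a m)).symm
    refine Eq.trans ?_ (powerToTensor_single φ hφ A N a (g.hom m))
    exact congrArg (powerToTensor φ hφ A N) (Finsupp.mapRange_single (hf := map_zero g.hom))
  · ext M : 3
    have := res_smulCommClass φ hφ M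
    exact BalTensor.hom_ext S R fun m a => powerToTensor_tensorToPower φ hφ σ hσ M m a

end Tensor

/-! ### The complex `Hom_R(P, X)`: projections, functoriality, homotopy invariance. -/

section Hom

variable {R S : Type u} [Ring R] [Ring S] (φ : R →+* S) (hφ : ∀ r s, φ r * s = s * φ r)

/-- The left `S`-module `Hom_R(A, M)`. -/
def homObj (A : ModuleCat.{u} R) (M : ModuleCat.{u} S) : ModuleCat.{u} S :=
  haveI := res_smulCommClass φ hφ M
  ModuleCat.of S (A →ₗ[R] res φ M)

/-- Postcomposition `Hom_R(A, M) ⟶ Hom_R(A, N)`. -/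
def homPost (A : ModuleCat.{u} R) {M N : ModuleCat.{u} S} (g : M ⟶ N) :
    homObj φ hφ A M ⟶ homObj φ hφ A N :=
  haveI := res_smulCommClass φ hφ M
  haveI := res_smulCommClass φ hφ N
  ModuleCat.ofHom (X := A →ₗ[R] res φ M) (Y := A →ₗ[R] res φ N)
    { toFun := fun f => ((ModuleCat.restrictScalars φ).map g).hom ∘ₗ f
      map_add' := fun _ _ => LinearMap.comp_add _ _ _
      map_smul' := fun s f => LinearMap.ext fun x => g.hom.map_smul s (f x) }

/-- Precomposition `Hom_R(B, M) ⟶ Hom_R(A, M)`. -/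
def homPre {A B : ModuleCat.{u} R} (u : A ⟶ B) (M : ModuleCat.{u} S) :
    homObj φ hφ B M ⟶ homObj φ hφ A M :=
  haveI := res_smulCommClass φ hφ M
  ModuleCat.ofHom (X := B →ₗ[R] res φ M) (Y := A →ₗ[R] res φ M)
    { toFun := fun f => f ∘ₗ u.hom
      map_add' := fun _ _ => rfl
      map_smul' := fun _ _ => rfl }

theorem homPost_comp (A : ModuleCat.{u} R) {M N K : ModuleCat.{u} S} (g : M ⟶ N) (g' : N ⟶ K) :
    homPost φ hφ A (g ≫ g') = homPost φ hφ A g ≫ homPost φ hφ A g' := rfl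

theorem homPre_comp {A B C : ModuleCat.{u} R} (u : A ⟶ B) (v : B ⟶ C) (M : ModuleCat.{u} S) :
    homPre φ hφ (u ≫ v) M = homPre φ hφ v M ≫ homPre φ hφ u M := rfl

theorem homPre_id (A : ModuleCat.{u} R) (M : ModuleCat.{u} S) :
    homPre φ hφ (𝟙 A) M = 𝟙 _ := rfl

theorem homPre_add {A B : ModuleCat.{u} R} (u v : A ⟶ B) (M : ModuleCat.{u} S) :
    homPre φ hφ (u + v) M = homPre φ hφ u M + homPre φ hφ v M := by
  ext1
  exact LinearMap.ext fun f => LinearMap.ext fun x => map_add (show B →ₗ[R] res φ M from f) _ _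

theorem homPre_sub {A B : ModuleCat.{u} R} (u v : A ⟶ B) (M : ModuleCat.{u} S) :
    homPre φ hφ (u - v) M = homPre φ hφ u M - homPre φ hφ v M := by
  rw [eq_sub_iff_add_eq, ← homPre_add, sub_add_cancel]

theorem homPre_post {A B : ModuleCat.{u} R} (u : A ⟶ B) {M N : ModuleCat.{u} S} (g : M ⟶ N) :
    homPre φ hφ u M ≫ homPost φ hφ A g = homPost φ hφ B g ≫ homPre φ hφ u N := rfl

/-- The functor `Hom_R(A, -)`. -/
def homFunctor (A : ModuleCat.{u} R) : ModuleCat.{u} S ⥤ ModuleCat.{u} S where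
  obj M := homObj φ hφ A M
  map g := homPost φ hφ A g

instance (A : ModuleCat.{u} R) : (homFunctor φ hφ A).Additive where

/-- The projection of `Hom_R(P, X)_l` to the factor `Hom_R(P_p, X_q)`. -/
def homπ (P : Cx R) (X : Cx S) (l p q : ℤ) (h : p + l = q) :
    (homComplex φ hφ P X).X l ⟶ homObj φ hφ (P.X p) (X.X q) :=
  haveI := fun q => res_smulCommClass φ hφ (X.X q)
  ModuleCat.ofHom (X := ∀ a : HomIndex l, (P.X a.1.1 →ₗ[R] res φ (X.X a.1.2)))
    (Y := P.X p →ₗ[R] res φ (X.X q))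
    (LinearMap.proj (R := S)
      (φ := fun a : HomIndex l => P.X a.1.1 →ₗ[R] res φ (X.X a.1.2)) ⟨(p, q), h⟩)

/-- The morphism to `Hom_R(P, X)_l` with given components. -/
def homLift {P : Cx R} {X : Cx S} {l : ℤ} {M : ModuleCat.{u} S}
    (f : ∀ p q : ℤ, p + l = q → (M ⟶ homObj φ hφ (P.X p) (X.X q))) :
    M ⟶ (homComplex φ hφ P X).X l :=
  haveI := fun q => res_smulCommClass φ hφ (X.X q)
  ModuleCat.ofHom (X := M) (Y := ∀ a : HomIndex l, (P.X a.1.1 →ₗ[R] res φ (X.X a.1.2)))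
    (LinearMap.pi (R := S)
      (φ := fun a : HomIndex l => P.X a.1.1 →ₗ[R] res φ (X.X a.1.2))
      fun a => (f a.1.1 a.1.2 a.2).hom)

theorem homLift_π {P : Cx R} {X : Cx S} {l : ℤ} {M : ModuleCat.{u} S}
    (f : ∀ p q : ℤ, p + l = q → (M ⟶ homObj φ hφ (P.X p) (X.X q))) (p q : ℤ) (h : p + l = q) :
    homLift φ hφ f ≫ homπ φ hφ P X l p q h = f p q h := rfl

theorem hom_ext_π {P : Cx R} {X : Cx S} {l : ℤ} {M : ModuleCat.{u} S}
    {f g : M ⟶ (homComplex φ hφ P X).X l}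
    (h : ∀ p q (hpq : p + l = q), f ≫ homπ φ hφ P X l p q hpq = g ≫ homπ φ hφ P X l p q hpq) :
    f = g := by
  ext1
  refine LinearMap.ext fun x => funext fun ⟨⟨p, q⟩, hpq⟩ => ?_
  exact congrArg (fun f => f.hom x) (h p q hpq)

theorem homComplex_d_π (P : Cx R) (X : Cx S) (i j p q p' q' : ℤ) (h : p + j = q)
    (hp' : p' + i = q) (hq' : p + i = q') :
    (homComplex φ hφ P X).d i j ≫ homπ φ hφ P X j p q h =
      homπ φ hφ P X i p q' hq' ≫ homPost φ hφ (P.X p) (X.d q' q) -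
        i.negOnePow • homπ φ hφ P X i p' q hp' ≫ homPre φ hφ (P.d p p') (X.X q) := by
  subst hq'
  obtain rfl : p' = q - i := by lia
  rfl

/-- `Hom_R(P, g)` for a morphism `g` of complexes. -/
def homMap (P : Cx R) {X Y : Cx S} (g : X ⟶ Y) : homComplex φ hφ P X ⟶ homComplex φ hφ P Y where
  f l := homLift φ hφ fun p q h => homπ φ hφ P X l p q h ≫ homPost φ hφ (P.X p) (g.f q)
  comm' i j _ := by
    refine hom_ext_π φ hφ fun p q h => ?_
    rw [Category.assoc, Category.assoc, homLift_π,
      homComplex_d_π φ hφ P Y i j p q (q - i) (p + i) h (by lia) rfl,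
      ← Category.assoc ((homComplex φ hφ P X).d i j),
      homComplex_d_π φ hφ P X i j p q (q - i) (p + i) h (by lia) rfl,
      Preadditive.comp_sub, Preadditive.sub_comp, Linear.comp_units_smul, Linear.units_smul_comp,
      ← Category.assoc, ← Category.assoc, homLift_π, homLift_π, Category.assoc, Category.assoc,
      Category.assoc, Category.assoc, homPre_post, ← homPost_comp, ← homPost_comp, g.comm]

/-- `Hom_R(u, X)` for a morphism `u` of complexes. -/
def homMapLeft {P Q : Cx R} (u : P ⟶ Q) (X : Cx S) :
    homComplex φ hφ Q X ⟶ homComplex φ hφ P X where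
  f l := homLift φ hφ fun p q h => homπ φ hφ Q X l p q h ≫ homPre φ hφ (u.f p) (X.X q)
  comm' i j _ := by
    refine hom_ext_π φ hφ fun p q h => ?_
    rw [Category.assoc, Category.assoc, homLift_π,
      homComplex_d_π φ hφ P X i j p q (q - i) (p + i) h (by lia) rfl,
      ← Category.assoc ((homComplex φ hφ Q X).d i j),
      homComplex_d_π φ hφ Q X i j p q (q - i) (p + i) h (by lia) rfl,
      Preadditive.comp_sub, Preadditive.sub_comp, Linear.comp_units_smul, Linear.units_smul_comp,
      ← Category.assoc, ← Category.assoc, homLift_π, homLift_π, Category.assoc, Category.assoc,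
      Category.assoc, Category.assoc, homPre_post, ← homPre_comp, ← homPre_comp, u.comm]

/-- Precomposition with a homotopy from `u` to `v`, twisted by `(-1)^l` in source degree `l`. The
twist cancels the sign of the precomposition term of the differential, and makes the two
postcomposition terms cancel each other. -/
theorem nonempty_homotopy_homMapLeft {P Q : Cx R} {u v : P ⟶ Q} (h : Homotopy u v) (X : Cx S) :
    Nonempty (Homotopy (homMapLeft φ hφ u X) (homMapLeft φ hφ v X)) := by
  obtain ⟨k, hk⟩ := (nonempty_homotopy_zero_iff _).1 ((nonempty_homotopy_iff u v).1 ⟨h⟩)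
  let H (l m : ℤ) : (homComplex φ hφ Q X).X l ⟶ (homComplex φ hφ P X).X m :=
    homLift φ hφ fun p q _ => l.negOnePow •
      homπ φ hφ Q X l (q - l) q (by lia) ≫ homPre φ hφ (k p (q - l)) (X.X q)
  have hH (l m p q p' : ℤ) (h : p + m = q) (h' : p' + l = q) :
      H l m ≫ homπ φ hφ P X m p q h =
        l.negOnePow • homπ φ hφ Q X l p' q h' ≫ homPre φ hφ (k p p') (X.X q) := by
    obtain rfl : p' = q - l := by lia
    rfl
  refine (nonempty_homotopy_iff _ _).2 ((nonempty_homotopy_zero_iff _).2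
    ⟨H, fun i j m hij him => hom_ext_π φ hφ fun p q hpq => ?_⟩)
  have hk' := hk p (p - 1) (p + 1) (by lia) rfl
  have e1 : j.negOnePow = - i.negOnePow := by rw [← hij, Int.negOnePow_succ, neg_neg]
  have e2 : m.negOnePow = - i.negOnePow := by rw [← him, Int.negOnePow_succ]
  have e3 : (homMapLeft φ hφ u X - homMapLeft φ hφ v X).f i ≫ homπ φ hφ P X i p q hpq =
      homπ φ hφ Q X i p q hpq ≫ homPre φ hφ ((u - v).f p) (X.X q) := by
    rw [HomologicalComplex.sub_f_apply, HomologicalComplex.sub_f_apply, Preadditive.sub_comp,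
      homPre_sub, Preadditive.comp_sub]
    rfl
  rw [e3, hk', homPre_add, Preadditive.add_comp, Category.assoc, Category.assoc,
    hH j i p q (p + 1) hpq (by lia),
    homComplex_d_π φ hφ P X m i p q (p - 1) (q + 1) hpq (by lia) (by lia),
    Preadditive.comp_sub, ← Category.assoc (H i m), hH i m p (q + 1) (p + 1) (by lia) (by lia),
    Linear.comp_units_smul, Linear.comp_units_smul, ← Category.assoc (H i m),
    hH i m (p - 1) q p (by lia) hpq, ← Category.assoc ((homComplex φ hφ Q X).d i j),
    homComplex_d_π φ hφ Q X i j (p + 1) q p (q + 1) (by lia) hpq (by lia),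
    Preadditive.sub_comp, Preadditive.comp_add, homPre_comp, homPre_comp, Linear.units_smul_comp,
    Linear.units_smul_comp, Linear.units_smul_comp, e1, e2, smul_sub, Units.neg_smul, Units.neg_smul, Units.neg_smul,
    smul_smul, smul_smul, Int.units_mul_self, one_smul, one_smul, Category.assoc, Category.assoc,
    Category.assoc, Category.assoc, homPre_post]
  abel

/-- `Hom_R(P, X)` depends on `P` only up to homotopy equivalence. -/
theorem quasiIsomorphic_homComplex {P Q : Cx R} (e : HomotopyEquiv P Q) (X : Cx S) :
    QuasiIsomorphic (homComplex φ hφ P X) (homComplex φ hφ Q X) := by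
  obtain ⟨h₁⟩ := nonempty_homotopy_homMapLeft φ hφ e.homotopyHomInvId X
  obtain ⟨h₂⟩ := nonempty_homotopy_homMapLeft φ hφ e.homotopyInvHomId X
  exact .of_homotopyEquiv ⟨homMapLeft φ hφ e.inv X, homMapLeft φ hφ e.hom X, h₁, h₂⟩

end Hom

/-! ### `Hom_R(P, -)` as a triangular functor. -/

section HomTriangular

variable {R S : Type u} [Ring R] [Ring S] (φ : R →+* S) (hφ : ∀ r s, φ r * s = s * φ r)

theorem isZero_homObj (A : ModuleCat.{u} R) (hA : Subsingleton A) (M : ModuleCat.{u} S) :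
    IsZero (homObj φ hφ A M) := by
  rw [IsZero.iff_id_eq_zero, ← homPre_id,
    (ModuleCat.isZero_of_subsingleton A).eq_of_src (𝟙 A) 0]
  rw [show (0 : A ⟶ A) = 0 - 0 from (sub_zero 0).symm, homPre_sub, sub_self]

/-- The inclusion of a factor of `Hom_R(P, X)`. -/
def homι (P : Cx R) (X : Cx S) (l p q : ℤ) (h : p + l = q) :
    homObj φ hφ (P.X p) (X.X q) ⟶ (homComplex φ hφ P X).X l :=
  homLift φ hφ fun p' q' h' => if hp : p' = p then homPre φ hφ (P.XIsoOfEq hp).hom (X.X q) ≫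
    homPost φ hφ (P.X p') (X.XIsoOfEq (show q = q' by lia)).hom else 0

theorem homι_π (P : Cx R) (X : Cx S) (l p q : ℤ) (h : p + l = q) :
    homι φ hφ P X l p q h ≫ homπ φ hφ P X l p q h = 𝟙 _ := by
  rw [homι, homLift_π, dif_pos rfl]
  rfl

theorem homι_π_of_ne (P : Cx R) (X : Cx S) (l p q p' q' : ℤ) (h : p + l = q)
    (h' : p' + l = q') (hp : p' ≠ p) :
    homι φ hφ P X l p q h ≫ homπ φ hφ P X l p' q' h' = 0 := by
  rw [homι, homLift_π, dif_neg hp]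

theorem hom_sum_π_ι (P : Cx R) (X : Cx S) (s t : ℤ)
    (hP : ∀ i, (i < s ∨ t < i) → Subsingleton (P.X i)) (l : ℤ) :
    ∑ p ∈ Finset.Icc (-t) (-s), homπ φ hφ P X l (-p) (l - p) (by lia) ≫
      homι φ hφ P X l (-p) (l - p) (by lia) = 𝟙 _ := by
  refine hom_ext_π φ hφ fun p q h => ?_
  obtain ⟨p, rfl⟩ : ∃ p', p = -p' := ⟨-p, (neg_neg p).symm⟩
  rw [Preadditive.sum_comp]
  by_cases hp : p ∈ Finset.Icc (-t) (-s)
  · rw [Finset.sum_eq_single_of_mem p hp]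
    · obtain rfl : q = l - p := by lia
      rw [Category.assoc, homι_π, Category.id_comp, Category.comp_id]
    · intro p' _ hp'
      rw [Category.assoc, homι_π_of_ne _ _ _ _ _ _ _ _ _ _ _ (by lia), comp_zero]
  · exact (isZero_homObj φ hφ _
      (hP (-p) (by rw [Finset.mem_Icc] at hp; lia)) _).eq_of_tgt _ _

theorem homι_map (P : Cx R) {X Y : Cx S} (g : X ⟶ Y) (l p q : ℤ) (h : p + l = q) :
    homι φ hφ P X l p q h ≫ (homMap φ hφ P g).f l =
      homPost φ hφ (P.X p) (g.f q) ≫ homι φ hφ P Y l p q h := by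
  refine hom_ext_π φ hφ fun p' q' h' => ?_
  rw [Category.assoc, homMap, homLift_π]
  by_cases hp : p' = p
  · subst hp
    obtain rfl : q = q' := by lia
    rw [← Category.assoc, homι_π, Category.assoc, homι_π, Category.id_comp, Category.comp_id]
  · rw [← Category.assoc, homι_π_of_ne _ _ _ _ _ _ _ _ _ _ _ hp, Category.assoc,
      homι_π_of_ne _ _ _ _ _ _ _ _ _ _ _ hp, zero_comp, comp_zero]

theorem homPost_zero (A : ModuleCat.{u} R) (M N : ModuleCat.{u} S) :
    homPost φ hφ A (0 : M ⟶ N) = 0 := rfl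

theorem homι_d_π (P : Cx R) (X : Cx S) (p q q' l l' : ℤ) (h : p + l = q) (h' : p + l' = q') :
    homι φ hφ P X l p q h ≫ (homComplex φ hφ P X).d l l' ≫ homπ φ hφ P X l' p q' h' =
      homPost φ hφ (P.X p) (X.d q q') := by
  by_cases hl : l' + 1 = l
  · rw [homComplex_d_π φ hφ P X l l' p q' (q' - l) q (by lia) (by lia) (by lia),
      Preadditive.comp_sub, Linear.comp_units_smul, ← Category.assoc, homι_π, ← Category.assoc,
      homι_π_of_ne _ _ _ _ _ _ _ _ _ _ _ (by lia), zero_comp, smul_zero, sub_zero,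
      Category.id_comp]
  · rw [HomologicalComplex.shape _ _ _ hl, zero_comp, comp_zero, X.shape _ _ (by
      change q' + 1 ≠ q; lia), homPost_zero]

theorem homι_d_π_of_lt (P : Cx R) (X : Cx S) (p q p' q' l l' : ℤ) (h : p + l = q)
    (h' : p' + l' = q') (hp : p' < p) :
    homι φ hφ P X l p q h ≫ (homComplex φ hφ P X).d l l' ≫ homπ φ hφ P X l' p' q' h' = 0 := by
  by_cases hl : l' + 1 = l
  · rw [homComplex_d_π φ hφ P X l l' p' q' (q' - l) (p' + l) (by lia) (by lia) rfl,
      Preadditive.comp_sub, Linear.comp_units_smul, ← Category.assoc,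
      homι_π_of_ne _ _ _ _ _ _ _ _ _ _ _ (by lia), ← Category.assoc,
      homι_π_of_ne _ _ _ _ _ _ _ _ _ _ _ (by lia), zero_comp, zero_comp, smul_zero, sub_zero]
  · rw [HomologicalComplex.shape _ _ _ hl, zero_comp, comp_zero]

/-- The functor `Hom_R(P, -)` for a bounded complex `P`. -/
def homTriangular (P : Cx R) (s t : ℤ)
    (hP : ∀ i, (i < s ∨ t < i) → Subsingleton (P.X i)) : TriangularFunctor S where
  obj X := homComplex φ hφ P X
  map g := homMap φ hφ P g
  -- The factor `Hom_R(P_p, X_{p+l})` contributes to column `-p`. Support of `P` in `[s, t]` becomes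
  -- columns in `[-t, -s]`, with top column `-s`.
  F p := homFunctor φ hφ (P.X (-p))
  additive p := inferInstance
  sign p := 1
  a := -t
  b := -s
  ι X p q l h := homι φ hφ P X l (-p) q (by lia)
  π X p q l h := homπ φ hφ P X l (-p) q (by lia)
  ι_π X p q l h := homι_π φ hφ P X l (-p) q _
  ι_π_of_ne X p q p' q' l h h' hp := homι_π_of_ne φ hφ P X l (-p) q (-p') q' _ _ (by lia)
  sum_π_ι X := hom_sum_π_ι φ hφ P X s t hP
  ι_map {X Y} g p q l h := homι_map φ hφ P g l (-p) q _
  ι_d_π X p q q' l l' h h' :=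
    (homι_d_π φ hφ P X (-p) q q' l l' _ _).trans (one_smul ℤˣ _).symm
  ι_d_π_of_lt X p q p' q' l l' h h' hp :=
    homι_d_π_of_lt φ hφ P X (-p) q (-p') q' l l' _ _ (by lia)

/-- Dual basis: with generators `x i` and coordinates from `σ`, every `h` equals `a ↦ ∑ σ_i(a) h(x
i)`. Finiteness makes this sum available and lets the family `h(x i)` lie in a direct sum. -/
theorem isRetractOfPower_hom (A : ModuleCat.{u} R) (hA : Module.Finite R A)
    (hA' : Module.Projective R A) : IsRetractOfPower (homFunctor φ hφ A) := by
  classical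
  obtain ⟨n, f, hf⟩ := Module.Finite.exists_fin' R A
  obtain ⟨σ, hσ⟩ := Module.projective_lifting_property f LinearMap.id hf
  let x (i : ULift.{u} (Fin n)) : A := f (Pi.single i.down 1)
  have key (M : ModuleCat.{u} S) (h : A →ₗ[R] res φ M) (a : A) :
      ∑ i : ULift.{u} (Fin n), (σ a i.down) • h (x i) = h a := by
    simp only [x, ← map_smul, ← map_sum]
    refine congrArg h (Eq.trans (congrArg f ?_) (LinearMap.congr_fun hσ a))
    refine Eq.trans ?_ (pi_eq_sum_univ' (σ a)).symm
    exact Equiv.ulift.{u}.sum_comp fun i => σ a i • Pi.single (M := fun _ => R) i 1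
  refine ⟨ULift.{u} (Fin n),
    { app := fun M => ModuleCat.ofHom (X := homObj φ hφ A M) (Y := ULift.{u} (Fin n) →₀ M)
        { toFun := fun h => Finsupp.equivFunOnFinite.symm
            fun i => (show M from (show A →ₗ[R] res φ M from h) (x i))
          map_add' := fun _ _ => Finsupp.ext fun _ => rfl
          map_smul' := fun _ _ => Finsupp.ext fun _ => rfl }
      naturality := fun M N g => ?_ },
    { app := fun M => ModuleCat.ofHom (X := ULift.{u} (Fin n) →₀ M) (Y := homObj φ hφ A M)
        { toFun := fun k => show A →ₗ[R] res φ M from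
            { toFun := fun a => ∑ i, σ a i.down • (show res φ M from k i)
              map_add' := fun a b => by
                refine Eq.trans (Finset.sum_congr rfl fun i _ => ?_) Finset.sum_add_distrib
                rw [map_add]
                exact add_smul _ _ (show res φ M from k i)
              map_smul' := fun r a => by
                refine Eq.trans (Finset.sum_congr rfl fun i _ => ?_)
                  (Finset.smul_sum (M := R) (N := res φ M)).symm
                rw [map_smul]
                exact mul_smul _ _ (show res φ M from k i) }
          map_add' := fun k k' => LinearMap.ext fun a => by
            change ∑ i, φ (σ a i.down) • (k i + k' i) =
              ∑ i, φ (σ a i.down) • k i + ∑ i, φ (σ a i.down) • k' i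
            rw [← Finset.sum_add_distrib]
            exact Finset.sum_congr rfl fun i _ => smul_add _ _ _
          map_smul' := fun s k => LinearMap.ext fun a => by
            change ∑ i, φ (σ a i.down) • s • k i = s • ∑ i, φ (σ a i.down) • k i
            rw [Finset.smul_sum]
            -- Centrality again: the retraction is `S`-linear because `φ (σ_i(a))` commutes with
            -- `s`.
            exact Finset.sum_congr rfl fun i _ => by rw [smul_smul, smul_smul, hφ] }
      naturality := fun M N g => ?_ }, ?_⟩
  · ext h
    exact Finsupp.ext fun _ => rfl
  · ext1
    refine LinearMap.ext fun (k : ULift.{u} (Fin n) →₀ M) => LinearMap.ext fun a => ?_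
    change ∑ i, φ (σ a i.down) • g.hom (k i) = g.hom (∑ i, φ (σ a i.down) • k i)
    rw [map_sum]
    exact Finset.sum_congr rfl fun i _ => (g.hom.map_smul _ _).symm
  · ext M : 3
    exact LinearMap.ext fun h => LinearMap.ext fun a => key M h a

end HomTriangular

/-! ### Bounded complexes of projectives, and exact complexes. -/

section Bounded

variable {R : Type u} [Ring R]

/-- Bounded complexes of projective modules are DG-projective. -/
theorem isDGProjective_of_bounded {L : Cx R} (hL : ∀ i, Module.Projective R (L.X i)) (a b : ℤ)
    (h : ∀ i, (i < a ∨ b < i) → Subsingleton (L.X i)) : IsDGProjective L where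
  projective := hL
  homotopy_zero E hE f := by
    have h0 (i : ℤ) (hi : i < a ∨ b < i) : IsZero (L.X i) :=
      haveI := h i hi
      ModuleCat.isZero_of_subsingleton _
    -- The homotopy is built upwards from the bottom degree `a`, below which all terms of `L`
    -- vanish.
    have key (n : ℕ) : ∃ k : ∀ i j : ℤ, L.X i ⟶ E.X j, ∀ i < a + n,
        f.f i = L.d i (i - 1) ≫ k (i - 1) i + k i (i + 1) ≫ E.d (i + 1) i := by
      induction n with
      | zero => exact ⟨fun _ _ => 0, fun i hi => (h0 i (.inl (by simpa using hi))).eq_of_src _ _⟩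
      | succ n ih =>
        obtain ⟨k, hk⟩ := ih
        obtain ⟨m, hm⟩ : ∃ m : ℤ, m = a + n := ⟨_, rfl⟩
        rw [← hm] at hk
        have hz : (f.f m - L.d m (m - 1) ≫ k (m - 1) m) ≫ E.d m (m - 1) = 0 := by
          have := hk (m - 1) (by lia)
          rw [sub_add_cancel] at this
          rw [Preadditive.sub_comp, f.comm, this, Preadditive.comp_add, ← Category.assoc,
            L.d_comp_d, zero_comp, zero_add, Category.assoc, sub_self]
        have : Projective (L.X m) := (IsProjective.iff_projective _).1 (hL m)
        have hex := (E.exactAt_iff' (m + 1) m (m - 1) (by simp) (by simp)).1 (hE m)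
        let t : L.X m ⟶ E.X (m + 1) := hex.liftFromProjective _ hz
        have ht : t ≫ E.d (m + 1) m = f.f m - L.d m (m - 1) ≫ k (m - 1) m :=
          hex.liftFromProjective_comp _ hz
        -- Only the entry from degree `m` to `m + 1` changes; the equations in degrees below `m` do
        -- not involve it.
        refine ⟨Function.update k m (Function.update (k m) (m + 1) t), fun i hi => ?_⟩
        rw [Function.update_of_ne (a := i - 1) (by push_cast at hi; lia)]
        rcases eq_or_lt_of_le (show i ≤ m by push_cast at hi; lia) with rfl | hi
        · rw [Function.update_self, Function.update_self, ht]
          abel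
        · rw [Function.update_of_ne hi.ne]
          exact hk i hi
    obtain ⟨k, hk⟩ := key (b + 1 - a).toNat
    refine (nonempty_homotopy_zero_iff f).2 ⟨k, fun i j l hij hil => ?_⟩
    obtain rfl : j = i - 1 := by lia
    subst hil
    by_cases hi : b < i
    · exact (h0 i (.inr hi)).eq_of_src _ _
    · exact hk i (by lia)

theorem isDGProjective_of_isZero {Z : Cx R} (hZ : IsZero Z) : IsDGProjective Z where
  projective n := (IsProjective.iff_projective _).2
    ((HomologicalComplex.eval _ _ n).map_isZero hZ).projective
  homotopy_zero _ _ _ := ⟨Homotopy.ofEq (hZ.eq_of_src _ _)⟩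

theorem isTotallyFlatAcyclic_of_isZero {Z : Cx R} (hZ : IsZero Z) : IsTotallyFlatAcyclic Z where
  projective := (isDGProjective_of_isZero hZ).projective
  exact i := HomologicalComplex.ExactAt.of_isZero ((HomologicalComplex.eval _ _ i).map_isZero hZ)
  hom_exact F _ n _ _ :=
    ⟨0, ((HomologicalComplex.eval _ _ n).map_isZero hZ).eq_of_src (Y := F) _ _⟩

theorem quasiIso_of_acyclic {K L : Cx R} (g : K ⟶ L) (hK : K.Acyclic) (hL : L.Acyclic) :
    QuasiIso g := by
  rw [quasiIso_iff]
  exact fun i => (quasiIsoAt_iff_exactAt g i (hK i)).2 (hL i)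

theorem acyclic_of_isZero {Z : Cx R} (hZ : IsZero Z) : Z.Acyclic :=
  (isTotallyFlatAcyclic_of_isZero hZ).exact

/-- The zero complex, resolved by itself, is quasi-isomorphic to `Y` and gives the bound `n` for
every integer `n`. -/
theorem dpd_eq_bot_of_acyclic {Y : Cx R} (hY : Y.Acyclic) : dpd Y = ⊥ := by
  obtain ⟨Z, hZ⟩ : ∃ Z : Cx R, IsZero Z := HasZeroObject.zero
  let C : FCompleteResolution Z :=
    { T := Z
      P := Z
      τ := 𝟙 _
      π := 𝟙 _
      resolution := ⟨isDGProjective_of_isZero hZ, inferInstance⟩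
      totallyAcyclic := isTotallyFlatAcyclic_of_isZero hZ
      bijective := ⟨0, fun i _ => Function.bijective_id⟩ }
  have h (n : ℤ) : dpd Y ≤ ((n : ℝ) : EReal) :=
    dpd_le_of_quasiIsomorphic (.rel _ _ ⟨0, quasiIso_of_acyclic 0 (acyclic_of_isZero hZ) hY⟩) C n
      fun i _ => Function.bijective_id
  rw [EReal.eq_bot_iff_forall_lt]
  intro y
  refine (h (⌊y⌋ - 1)).trans_lt (EReal.coe_lt_coe_iff.2 ?_)
  push_cast
  linarith [Int.floor_le y]

theorem TriangularFunctor.acyclic_of_lt (Φ : TriangularFunctor R) (h : Φ.b < Φ.a) (X : Cx R) :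
    (Φ.obj X).Acyclic := fun i =>
  (exactAt_iff_forall i (i - 1) (i + 1) (by lia) rfl).2 fun x _ => ⟨0, by
    rw [map_zero]
    exact (Φ.eq_zero_of_π fun p q _ hp => by rw [Finset.mem_Icc] at hp; lia).symm⟩

end Bounded

/-! ### Truncation of a perfect complex at its lowest homology. -/

section Truncation

variable {R : Type u} [Ring R] (L : Cx R) (s : ℤ)

/-- The terms of the truncation of `L` that replaces `L_s` by the cycles and is zero below `s`. -/
def truncSubmodule (i : ℤ) : Submodule R (L.X i) where
  carrier := {x | (i < s → x = 0) ∧ (i ≤ s → ∀ j, (L.d i j).hom x = 0)}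
  add_mem' {x y} hx hy := ⟨fun h => by rw [hx.1 h, hy.1 h, add_zero],
    fun h j => by rw [map_add, hx.2 h, hy.2 h, add_zero]⟩
  zero_mem' := ⟨fun _ => rfl, fun _ _ => map_zero _⟩
  smul_mem' r x hx := ⟨fun h => by rw [hx.1 h, smul_zero],
    fun h j => by rw [map_smul, hx.2 h, smul_zero]⟩

theorem truncSubmodule_of_lt {i : ℤ} (h : i < s) : truncSubmodule L s i = ⊥ :=
  (Submodule.eq_bot_iff _).2 fun _ hx => hx.1 h

theorem truncSubmodule_of_gt {i : ℤ} (h : s < i) : truncSubmodule L s i = ⊤ :=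
  Submodule.eq_top_iff'.2 fun _ => ⟨fun h' => by lia, fun h' => by lia⟩

theorem truncSubmodule_self : truncSubmodule L s s = LinearMap.ker (L.d s (s - 1)).hom := by
  ext x
  exact ⟨fun hx => hx.2 le_rfl _,
    fun hx => ⟨fun h => (lt_irrefl _ h).elim, fun _ => d_eq_zero_of_d_pred hx⟩⟩

theorem d_mem_truncSubmodule (i j : ℤ) (x : L.X i) (hx : x ∈ truncSubmodule L s i) :
    (L.d i j).hom x ∈ truncSubmodule L s j := by
  refine ⟨fun h => ?_, fun _ _ => d_d_apply _ _ _ _ _⟩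
  by_cases hij : j + 1 = i
  · exact hx.2 (by lia) j
  · rw [L.shape _ _ hij]
    rfl

/-- The truncation of `L` at degree `s`. -/
def trunc : Cx R where
  X i := ModuleCat.of R (truncSubmodule L s i)
  d i j := ModuleCat.ofHom ((L.d i j).hom.restrict (d_mem_truncSubmodule L s i j))
  shape i j hij := by
    ext1
    refine LinearMap.ext fun x => Subtype.ext ?_
    change (L.d i j).hom x.1 = 0
    rw [L.shape _ _ hij]
    rfl
  d_comp_d' i j k _ _ := by
    ext1
    exact LinearMap.ext fun x => Subtype.ext (d_d_apply L i j k x.1)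

/-- The inclusion of the truncation. -/
def truncι : trunc L s ⟶ L where
  f i := ModuleCat.ofHom (truncSubmodule L s i).subtype

theorem quasiIso_truncι (hL : ∀ i < s, L.ExactAt i) : QuasiIso (truncι L s) := by
  rw [quasiIso_iff_coneExact]
  rintro i j k hij hik ⟨y, hy⟩ x hdy (hyx : y = (L.d i j).hom x)
  -- Above `s` the truncation contains all of `L_i`, so `x` itself serves as `w`. Otherwise `y` lies
  -- below degree `s` and vanishes, so `x` is a cycle: it lies in the truncation if `i = s`, and is
  -- a boundary by exactness if `i < s`.
  rcases lt_or_ge s i with hi | hi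
  · exact ⟨⟨x, by rw [truncSubmodule_of_gt L s hi]; trivial⟩, 0, Subtype.ext hyx.symm,
      by rw [map_zero, add_zero]; rfl⟩
  · obtain rfl : y = 0 := hy.1 (by lia)
    have hx : ∀ l, (L.d i l).hom x = 0 := d_eq_zero_of_d_pred (by
      obtain rfl : j = i - 1 := by lia
      exact hyx.symm)
    rcases eq_or_lt_of_le hi with rfl | hi
    · exact ⟨⟨x, fun h => (lt_irrefl _ h).elim, fun _ => hx⟩, 0, Subtype.ext (hx j),
        by rw [map_zero, add_zero]; rfl⟩
    · obtain ⟨z, hz⟩ := (exactAt_iff_forall i j k hij hik).1 (hL i hi) x (hx j)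
      exact ⟨0, z, Subtype.ext (map_zero _), by rw [map_zero, zero_add, hz]⟩

theorem projective_finite_ker {M N : Type*} [AddCommGroup M] [Module R M] [AddCommGroup N]
    [Module R N] (g : M →ₗ[R] N) (hg : Function.Surjective g) [Module.Projective R N]
    (hM : Module.Finite R M ∧ Module.Projective R M) :
    Module.Finite R (LinearMap.ker g) ∧ Module.Projective R (LinearMap.ker g) := by
  obtain ⟨hM₁, hM₂⟩ := hM
  obtain ⟨t, ht⟩ := Module.projective_lifting_property g LinearMap.id hg
  have ht' (x : N) : g (t x) = x := LinearMap.congr_fun ht x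
  let r : M →ₗ[R] LinearMap.ker g := (LinearMap.id - t ∘ₗ g).codRestrict _ fun x => by
    simp [ht']
  have hr : r ∘ₗ (LinearMap.ker g).subtype = LinearMap.id := by
    ext x
    simp [r]
  exact ⟨Module.Finite.of_surjective r fun x => ⟨x, LinearMap.congr_fun hr x⟩,
    Module.Projective.of_split _ r hr⟩

variable {L s} in
-- Only the cycles in degree `s` need an argument. Going up from the bottom, exactness below `s`
-- makes `L_j` surject onto the cycles in degree `j - 1`; these are projective by induction, so the
-- surjection splits and the cycles in degree `j` are a summand of `L_j`.
theorem finite_projective_trunc (hL : ∀ i, Module.Finite R (L.X i) ∧ Module.Projective R (L.X i))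
    (m : ℤ) (hm : ∀ i < m, Subsingleton (L.X i)) (hex : ∀ i < s, L.ExactAt i) (i : ℤ) :
    Module.Finite R ((trunc L s).X i) ∧ Module.Projective R ((trunc L s).X i) := by
  have key (n : ℕ) : ∀ j < m + n, j ≤ s →
      Module.Finite R (LinearMap.ker (L.d j (j - 1)).hom) ∧
        Module.Projective R (LinearMap.ker (L.d j (j - 1)).hom) := by
    induction n with
    | zero =>
      intro j hj _
      have := hm j (by simpa using hj)
      exact ⟨inferInstance, inferInstance⟩
    | succ n ih =>
      intro j hj hjs
      obtain ⟨-, hp⟩ := ih (j - 1) (by push_cast at hj; lia) (by lia)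
      let g : L.X j →ₗ[R] LinearMap.ker (L.d (j - 1) (j - 1 - 1)).hom :=
        (L.d j (j - 1)).hom.codRestrict _ fun x => d_d_apply _ _ _ _ _
      have hg : Function.Surjective g := fun ⟨x, hx⟩ => by
        obtain ⟨y, hy⟩ := (exactAt_iff_forall (j - 1) (j - 1 - 1) j (by lia) (by lia)).1
          (hex (j - 1) (by lia)) x hx
        exact ⟨y, Subtype.ext hy⟩
      have := projective_finite_ker g hg (hL j)
      rwa [show LinearMap.ker g = _ from LinearMap.ker_codRestrict _ _ _] at this
  change Module.Finite R (truncSubmodule L s i) ∧ Module.Projective R (truncSubmodule L s i)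
  rcases lt_trichotomy i s with hi | rfl | hi
  · rw [truncSubmodule_of_lt L s hi]
    exact ⟨inferInstance, inferInstance⟩
  · rw [truncSubmodule_self]
    exact key (i + 1 - m).toNat i (by lia) le_rfl
  · rw [truncSubmodule_of_gt L s hi]
    obtain ⟨h₁, h₂⟩ := hL i
    exact ⟨Module.Finite.equiv Submodule.topEquiv.symm,
      Module.Projective.of_equiv Submodule.topEquiv.symm⟩

theorem subsingleton_trunc_of_lt {i : ℤ} (h : i < s) : Subsingleton ((trunc L s).X i) := by
  change Subsingleton (truncSubmodule L s i)
  rw [truncSubmodule_of_lt L s h]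
  infer_instance

theorem subsingleton_trunc {i : ℤ} (h : Subsingleton (L.X i)) :
    Subsingleton ((trunc L s).X i) :=
  inferInstanceAs (Subsingleton (truncSubmodule L s i))

end Truncation

/-! ### The two inequalities. -/

section Bounds

variable {R S : Type u} [Ring R] [Ring S] (φ : R →+* S) (hφ : ∀ r s, φ r * s = s * φ r)

/-- Turns `inf U` and `pd U` for non-exact `U` into integers that are attained, so that an actual
complex realizes them. -/
theorem exists_eq_sInf {A : ℤ → Prop} (h : ∃ n, A n) (b : ℤ) (hb : ∀ n, A n → b ≤ n) :
    ∃ n, A n ∧ sInf {x : EReal | ∃ i : ℤ, x = ((i : ℝ) : EReal) ∧ A i} = ((n : ℝ) : EReal) := by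
  obtain ⟨n, hn, hn'⟩ := Int.exists_least_of_bdd ⟨b, hb⟩ h
  refine ⟨n, hn, le_antisymm (sInf_le ⟨n, rfl, hn⟩) (le_sInf ?_)⟩
  rintro _ ⟨i, rfl, hi⟩
  exact EReal.coe_le_coe_iff.2 (Int.cast_le.2 (hn' i hi))

/-- Since `m` is finite it can be moved across the inequality, which treats infinite values of `dpd
X` uniformly. -/
theorem le_dpd_add {X : Cx S} {y : EReal} (m : ℤ)
    (h : ∀ (C : FCompleteResolution X) (n : ℤ), (∀ i ≥ n, Function.Bijective (C.τ.f i)) →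
      y ≤ (((n + m : ℤ) : ℝ) : EReal)) : y ≤ dpd X + ((m : ℝ) : EReal) := by
  rw [← EReal.sub_le_iff_le_add (.inl (EReal.coe_ne_bot _)) (.inl (EReal.coe_ne_top _))]
  refine le_sInf ?_
  rintro _ ⟨n, rfl, C, hC⟩
  rw [EReal.sub_le_iff_le_add (.inl (EReal.coe_ne_bot _)) (.inl (EReal.coe_ne_top _))]
  exact_mod_cast h C n hC

theorem IsRHom.quasiIsomorphic {U L : Cx R} {X Y : Cx S} (hY : IsRHom φ hφ U X Y)
    (hL : IsDGProjective L) (h : QuasiIsomorphic L U) :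
    QuasiIsomorphic (homComplex φ hφ L X) Y := by
  obtain ⟨P, π, hπ, hY⟩ := hY
  obtain ⟨e⟩ := hπ.nonempty_homotopyEquiv hL h
  exact (quasiIsomorphic_homComplex φ hφ e X).trans _ _ _ hY

theorem IsLTensor.quasiIsomorphic {U L : Cx Rᵐᵒᵖ} {X Y : Cx S} (hY : IsLTensor φ hφ U X Y)
    (hL : IsDGProjective L) (h : QuasiIsomorphic L U) :
    QuasiIsomorphic (tensorComplex φ hφ L X) Y := by
  obtain ⟨P, π, hπ, hY⟩ := hY
  obtain ⟨e⟩ := hπ.nonempty_homotopyEquiv hL h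
  exact (quasiIsomorphic_tensorComplex φ hφ e X).trans _ _ _ hY

theorem exists_isDGProjective_of_acyclic {U : Cx R} (hU : U.Acyclic) :
    ∃ L : Cx R, IsDGProjective L ∧ QuasiIsomorphic L U ∧ ∀ i, Subsingleton (L.X i) := by
  obtain ⟨Z, hZ⟩ : ∃ Z : Cx R, IsZero Z := HasZeroObject.zero
  exact ⟨Z, isDGProjective_of_isZero hZ,
    .rel _ _ ⟨0, quasiIso_of_acyclic 0 (acyclic_of_isZero hZ) hU⟩,
    fun i => ModuleCat.subsingleton_of_isZero ((HomologicalComplex.eval _ _ i).map_isZero hZ)⟩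

theorem IsRHom.dpd_eq_bot {U : Cx R} {X Y : Cx S} (hY : IsRHom φ hφ U X Y) (hU : U.Acyclic) :
    dpd Y = ⊥ := by
  obtain ⟨L, hL, hLU, h0⟩ := exists_isDGProjective_of_acyclic hU
  refine dpd_eq_bot_of_acyclic fun i => ((hY.quasiIsomorphic φ hφ hL hLU).exactAt_iff i).1 ?_
  -- As all terms of `L` vanish, the crossed bounds `1` and `0` are allowed; they leave no columns
  -- at all.
  exact (homTriangular φ hφ L 1 0 fun i _ => h0 i).acyclic_of_lt (show (-1 : ℤ) < -0 by decide) X i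

theorem IsLTensor.dpd_eq_bot {U : Cx Rᵐᵒᵖ} {X Y : Cx S} (hY : IsLTensor φ hφ U X Y)
    (hU : U.Acyclic) : dpd Y = ⊥ := by
  obtain ⟨L, hL, hLU, h0⟩ := exists_isDGProjective_of_acyclic hU
  refine dpd_eq_bot_of_acyclic fun i => ((hY.quasiIsomorphic φ hφ hL hLU).exactAt_iff i).1 ?_
  exact (tensorTriangular φ hφ L 1 0 fun i _ => h0 i).acyclic_of_lt (zero_lt_one' ℤ) X i

theorem dpd_le_of_isRHom {U : Cx R} (hU : IsPerfect U) {X Y : Cx S} (hY : IsRHom φ hφ U X Y) :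
    dpd Y ≤ dpd X - cxInf U := by
  by_cases hac : U.Acyclic
  · rw [hY.dpd_eq_bot φ hφ hac]
    exact bot_le
  obtain ⟨L, hLU, hL, m, n, h0⟩ := hU
  -- The homology of `U` is bounded below by the support of `L`, so `inf U` is an integer `s`.
  have hlow (i : ℤ) (hi : ¬ U.ExactAt i) : m ≤ i := by
    by_contra! h
    have := h0 i (.inl h)
    exact hi ((hLU.exactAt_iff i).1 (HomologicalComplex.ExactAt.of_isZero
      (ModuleCat.isZero_of_subsingleton _)))
  obtain ⟨s, hs, hs'⟩ := exists_eq_sInf (A := fun i => ¬ U.ExactAt i)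
    (by simpa [HomologicalComplex.Acyclic] using hac) m hlow
  have hex (i : ℤ) (hi : i < s) : L.ExactAt i := by
    rw [hLU.exactAt_iff i]
    by_contra h
    have : ((s : ℝ) : EReal) ≤ ((i : ℝ) : EReal) := hs' ▸ sInf_le ⟨i, rfl, h⟩
    exact absurd (Int.cast_le.1 (EReal.coe_le_coe_iff.1 this)) (by lia)
  have hfp := finite_projective_trunc hL m (fun i hi => h0 i (.inl hi)) hex
  have h0' (i : ℤ) (hi : i < s ∨ n < i) : Subsingleton ((trunc L s).X i) := by
    rcases hi with hi | hi
    · exact subsingleton_trunc_of_lt L s hi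
    · exact subsingleton_trunc L s (h0 i (.inr hi))
  have hY' := hY.quasiIsomorphic φ hφ
    (isDGProjective_of_bounded (fun i => (hfp i).2) s n h0')
    (.trans _ _ _ (.rel _ _ ⟨truncι L s, quasiIso_truncι L s hex⟩) hLU)
  have key := le_dpd_add (X := X) (-s) fun C k hk =>
    (homTriangular φ hφ (trunc L s) s n h0').dpd_le
      (fun p => isRetractOfPower_hom φ hφ _ (hfp (-p)).1 (hfp (-p)).2) hY' C k hk
  rw [show cxInf U = ((s : ℝ) : EReal) from hs', sub_eq_add_neg]
  exact_mod_cast key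

theorem dpd_le_of_isLTensor {U : Cx Rᵐᵒᵖ} (hU : pd U < ⊤) {X Y : Cx S}
    (hY : IsLTensor φ hφ U X Y) : dpd Y ≤ dpd X + pd U := by
  by_cases hac : U.Acyclic
  · rw [hY.dpd_eq_bot φ hφ hac]
    exact bot_le
  obtain ⟨_, ⟨n₀, rfl, hn₀⟩, -⟩ := sInf_lt_iff.1 hU
  obtain ⟨i, hi⟩ : ∃ i, ¬ U.ExactAt i := by simpa [HomologicalComplex.Acyclic] using hac
  -- Nonzero homology in degree `i` forces every admissible `n` to be at least `i`, so the infimum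
  -- defining `pd U` is attained.
  obtain ⟨n, ⟨L, hLU, hL, ⟨m, hm⟩, hn⟩, hn'⟩ := exists_eq_sInf
    (A := fun n => ∃ P : Cx Rᵐᵒᵖ, QuasiIsomorphic P U ∧ (∀ i, Module.Projective Rᵐᵒᵖ (P.X i)) ∧
      (∃ m : ℤ, ∀ i < m, Subsingleton (P.X i)) ∧ ∀ i > n, Subsingleton (P.X i)) ⟨n₀, hn₀⟩ i (by
    rintro n ⟨L, hLU, -, -, hn⟩
    by_contra! h
    have := hn i h
    exact hi ((hLU.exactAt_iff i).1 (HomologicalComplex.ExactAt.of_isZero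
      (ModuleCat.isZero_of_subsingleton _))))
  have h0 (i : ℤ) (hi : i < m ∨ n < i) : Subsingleton (L.X i) := hi.elim (hm i) (hn i)
  have hY' := hY.quasiIsomorphic φ hφ (isDGProjective_of_bounded hL m n h0) hLU
  rw [show pd U = ((n : ℝ) : EReal) from hn']
  exact le_dpd_add (X := X) n fun C k hk => (tensorTriangular φ hφ L m n h0).dpd_le
    (fun p => isRetractOfPower_tensor φ hφ _ (hL p)) hY' C k hk

end Bounds

end DingProj

end

theorem mainTheorem9 {R S : Type u} [Ring R] [Ring S] (φ : R →+* S)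
    (hφ : ∀ r s, φ r * s = s * φ r)
    (X : DingProj.Cx S) (hX : DingProj.HomologicallyBoundedBelow X) :
    (∀ U : DingProj.Cx R, DingProj.IsPerfect U →
      ∀ Y : DingProj.Cx S, DingProj.IsRHom φ hφ U X Y →
        DingProj.dpd Y ≤ DingProj.dpd X - DingProj.cxInf U) ∧
    (∀ U : DingProj.Cx Rᵐᵒᵖ, DingProj.pd U < ⊤ →
      ∀ Y : DingProj.Cx S, DingProj.IsLTensor φ hφ U X Y →
        DingProj.dpd Y ≤ DingProj.dpd X + DingProj.pd U) :=
  ⟨fun _ hU _ hY => DingProj.dpd_le_of_isRHom φ hφ hU hY,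
    fun _ hU _ hY => DingProj.dpd_le_of_isLTensor φ hφ hU hY⟩
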